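/- Let $N\in\mathbb N$ and let $R(k_1,k_2)=\big(R_{i_1i_2}^{j_1j_2}(k_1,k_2)\big)$, $k_1,k_2\in\mathbb R$, be a continuous exchange factor on $\mathbb C^N\otimes\mathbb C^N$ (lower indices label rows) with $R_{12}(k_1,k_2)R_{12}(k_2,k_1)=1$ and $$R_{12}(k_1,k_2)R_{23}(k_1,k_3)R_{12}(k_2,k_3)=R_{23}(k_2,k_3)R_{12}(k_1,k_3)R_{23}(k_1,k_2).$$ The boundary algebra $\mathcal B_R$ has generators $a_i(k)$, $a^{*i}(k)$ (bulk) and $b_i^j(k)$ (boundary), $1\le i,j\le N$, $k\in\mathbb R$, and relations (repeated upper and lower indices are summed) $$a_{i_1}(k_1)a_{i_2}(k_2)=R_{i_2i_1}^{j_1j_2}(k_2,k_1)\,a_{j_2}(k_2)a_{j_1}(k_1),\qquad a^{*i_1}(k_1)a^{*i_2}(k_2)=a^{*j_2}(k_2)a^{*j_1}(k_1)R_{j_2j_1}^{i_1i_2}(k_2,k_1),$$ $$a_{i_1}(k_1)a^{*i_2}(k_2)=a^{*j_2}(k_2)R_{i_1j_2}^{i_2j_1}(k_1,k_2)a_{j_1}(k_1)+2\pi\delta(k_1-k_2)\delta_{i_1}^{i_2}\mathbf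 1+2\pi\delta(k_1+k_2)b_{i_1}^{i_2}(k_1),$$ $$R_{i_1i_2}^{l_2l_1}(k_1,k_2)b_{l_1}^{m_1}(k_1)R_{l_2m_1}^{j_1m_2}(k_2,-k_1)b_{m_2}^{j_2}(k_2)=b_{i_2}^{l_2}(k_2)R_{i_1l_2}^{m_2m_1}(k_1,-k_2)b_{m_1}^{l_1}(k_1)R_{m_2l_1}^{j_1j_2}(-k_2,-k_1),$$ $$a_{i_1}(k_1)b_{i_2}^{j_2}(k_2)=R_{i_2i_1}^{l_1l_2}(k_2,k_1)b_{l_2}^{m_2}(k_2)R_{l_1m_2}^{j_2m_1}(k_1,-k_2)a_{m_1}(k_1),$$ $$b_{i_1}^{j_1}(k_1)a^{*i_2}(k_2)=a^{*m_2}(k_2)R_{i_1m_2}^{l_2m_1}(k_1,k_2)b_{m_1}^{l_1}(k_1)R_{l_2l_1}^{j_1i_2}(k_2,-k_1).$$ A *representation* of $\mathcal B_R$ consists of a complex vector space $V$ (the common invariant domain) in duality with a space $W$ by a sesquilinear pairing $\langle\varphi,\psi\rangle$ that separates the points of $V$ (for instance $W=V=D$, a dense invariant domain of a Hilbert space, with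 the scalar product), in which the generators are operator-valued distributions satisfying these relations. Here $a_i(k)$ acts pointwise in $k$ on $V$; $a^{*i}(k)$ acts pointwise in $k$ on $W$ (to the left, i.e. it is a form on $W\times V$); $b_i^j(k)$ acts pointwise on both; after smearing with $f\in C_c^\infty(\mathbb R)$ the operators $a^{*i}(f)$ and $a_i(f)$ act also on $V$ and (to the left) on $W$, respectively; and the matrix elements between $W$ and $V$ of normally ordered products $a^{*}(k_1)\cdots a^{*}(k_r)\,b(l_1)\cdots b(l_t)\,a(p_1)\cdots a(p_s)$ are continuous in all momenta and, for every $m\in\mathbb N$, bounded by $C(1+|l|)^d(1+|k|+|p|)^{-m}$ with $C,d$ independent of the momenta. The relation between $a$ and $a^*$ is understood smeared with $f(k_1)g(k_2)$, $f,g\in C_c^\infty(\mathbb R)$. For $n\in\mathbb N$, the operator $$H_n=\int_{-\infty}^{\infty}dp\,p^n\,a^{*i}(p)\,a_i(p)$$ on $V$ is understood through its matrix elements (the representation is assumed to carry the operators $H_n$ in question). Then: 1. In every representation of $\mathcal B_R$, $[H_n,b_i^j(k)]=0$ for all $n,i,j,k$; hence $H_n$ commutes with the whole algebra generated by the $b_i^j(k)$,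 i.e. the boundary operators generate integrals of motion. 2. In every representation of $\mathcal B_R$, for all $n,m\in\mathbb N$, in the sense of (absolutely convergent) matrix elements, $$[H_n,H_m]=2\pi\,\big((-1)^n-(-1)^m\big)\int_{-\infty}^\infty dp\,p^{m+n}\,a^{*i}(-p)\,b_i^j(-p)\,a_j(p).$$ (If $dp$ is replaced by $dp/2\pi$ in all these integrals, the factor $2\pi$ disappears.) 3. In particular $[H_n,H_m]=0$ if $n$ and $m$ have the same parity; so the even Hamiltonians $H_{2n}$ form a commuting hierarchy. Hamiltonians of opposite parity do not commute in general: for every $N\ge1$ there are an exchange factor $R$ and a representation of $\mathcal B_R$ carrying all $H_n$ in which $[H_n,H_m]\neq0$ whenever $n$ and $m$ have opposite parity. 4. The odd Hamiltonians give no useful hierarchy: $H_{2n+1}=0$ in every Fock representation. Here a Fock representation is one on a dense domain $D$ of a Hilbert space, with $W=V=D$ and the scalar product as pairing, in which the involution $a_i(k)\leftrightarrow a^{*i}(k)$, $b_i^j(k)\mapsto b_j^i(-k)$ is realized as Hermitian conjugation, $b_i^l(k)b_l^j(-k)=\delta_i^j$, and there is a unit vector $\Omega\in D$ with $a_i(k)\Omega=0$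 that is cyclic for the $a^{*i}$. -/

import Mathlib

open MeasureTheory Matrix

noncomputable section

/-- An exchange factor `R(k₁, k₂)`: the entry `R k₁ k₂ (i₁, i₂) (j₁, j₂)` is
`R_{i₁ i₂}^{j₁ j₂}(k₁, k₂)`, lower indices label rows and upper indices columns. -/
abbrev ExchangeFactor (N : ℕ) : Type :=
  ℝ → ℝ → Matrix (Fin N × Fin N) (Fin N × Fin N) ℂ

/-- `M ⊗ 1`, acting on the first two of three tensor factors. -/
def onFirstTwo {N : ℕ} (M : Matrix (Fin N × Fin N) (Fin N × Fin N) ℂ) :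
    Matrix (Fin N × Fin N × Fin N) (Fin N × Fin N × Fin N) ℂ :=
  Matrix.of fun i j => if i.2.2 = j.2.2 then M (i.1, i.2.1) (j.1, j.2.1) else 0

/-- `1 ⊗ M`, acting on the last two of three tensor factors. -/
def onLastTwo {N : ℕ} (M : Matrix (Fin N × Fin N) (Fin N × Fin N) ℂ) :
    Matrix (Fin N × Fin N × Fin N) (Fin N × Fin N × Fin N) ℂ :=
  Matrix.of fun i j => if i.1 = j.1 then M i.2 j.2 else 0

/-- Unitarity `R₁₂(k₁,k₂) R₁₂(k₂,k₁) = 1` and the spectral quantum Yang-Baxter equation in braid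
form, for a continuous exchange factor (continuity is what makes the product of `R` with the
distributions in the exchange relations meaningful). -/
structure IsExchangeFactor {N : ℕ} (R : ExchangeFactor N) : Prop where
  continuous : Continuous fun k : ℝ × ℝ => R k.1 k.2
  unitarity : ∀ k₁ k₂ : ℝ, R k₁ k₂ * R k₂ k₁ = 1
  yangBaxter : ∀ k₁ k₂ k₃ : ℝ,
    onFirstTwo (R k₁ k₂) * onLastTwo (R k₁ k₃) * onFirstTwo (R k₂ k₃) =
      onLastTwo (R k₂ k₃) * onFirstTwo (R k₁ k₃) * onLastTwo (R k₁ k₂)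

/-- Complex test functions on the momentum line: smooth with compact support. -/
abbrev MomentumTest : Type := TestFunction (⊤ : TopologicalSpace.Opens ℝ) ℂ ⊤

/-- A representation of the boundary algebra `B_R` by operator valued distributions on a common
invariant domain `V` ("kets"), in duality with a space `W` of "bras" by a sesquilinear pairing
`⟨φ, ψ⟩`.  A dense invariant domain `D` of a Hilbert space is the case `W = V = D` with the scalar
product as pairing.

As usual for annihilation and creation operators, `a_i(k)` acts pointwise in `k` on kets, while
`a*^i(k)` is pointwise in `k` only as a sesquilinear form, that is, it acts pointwise on bras:
`⟨φ| a*^i(k) |ψ⟩ = ⟨aStarBra i k φ, ψ⟩`.  Smeared with a test function, `a*^i(f) = ∫ f(k) a*^i(k) dk`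
is an operator on kets and `a_i(f) = ∫ f(k) a_i(k) dk` an operator on bras. -/
structure BoundaryRep {N : ℕ} (R : ExchangeFactor N) (V W : Type*)
    [AddCommGroup V] [Module ℂ V] [AddCommGroup W] [Module ℂ W] where
  /-- The pairing `⟨φ, ψ⟩`, antilinear in `φ` and linear in `ψ`. -/
  pair : W →ₗ⋆[ℂ] V →ₗ[ℂ] ℂ
  /-- Kets are determined by their matrix elements. -/
  pair_separates : ∀ ψ : V, (∀ φ : W, pair φ ψ = 0) → ψ = 0
  /-- `a_i(k)` on kets. -/
  a : Fin N → ℝ → Module.End ℂ V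
  /-- `a*^i(k)` on bras. -/
  aStarBra : Fin N → ℝ → Module.End ℂ W
  /-- `b i j k` is `b_i^j(k)` on kets. -/
  b : Fin N → Fin N → ℝ → Module.End ℂ V
  /-- `b_i^j(k)` on bras. -/
  bBra : Fin N → Fin N → ℝ → Module.End ℂ W
  pair_bBra : ∀ i j k φ ψ, pair (bBra i j k φ) ψ = pair φ (b i j k ψ)
  /-- The smeared creation operator `a*^i(f)` on kets. -/
  aStarSmeared : Fin N → MomentumTest → Module.End ℂ V
  pair_aStarSmeared : ∀ i f φ ψ,
    pair φ (aStarSmeared i f ψ) = ∫ k : ℝ, f k * pair (aStarBra i k φ) ψ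
  /-- The smeared annihilation operator `a_i(f)` on bras:
  `⟨aSmearedBra i f φ, ψ⟩ = ⟨φ| a_i(f) |ψ⟩`. -/
  aSmearedBra : Fin N → MomentumTest → Module.End ℂ W
  pair_aSmearedBra : ∀ i f φ ψ,
    pair (aSmearedBra i f φ) ψ = ∫ k : ℝ, f k * pair φ (a i k ψ)
  /-- The matrix elements
  `⟨φ| a*^{i₁}(k₁) ⋯ a*^{i_r}(k_r) b(l₁) ⋯ b(l_t) a_{j₁}(p₁) ⋯ a_{j_s}(p_s) |ψ⟩` of normal ordered
  products are continuous in all momenta, rapidly decreasing in the bulk momenta and polynomially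
  bounded in the boundary ones. -/
  regular : ∀ (r t s : ℕ) (I : Fin r → Fin N) (B : Fin t → Fin N × Fin N) (J : Fin s → Fin N)
    (φ : W) (ψ : V),
    let M : (Fin r → ℝ) → (Fin t → ℝ) → (Fin s → ℝ) → ℂ := fun k l p =>
      pair ((List.ofFn fun x => aStarBra (I x) (k x)).reverse.prod φ)
        ((List.ofFn fun x => b (B x).1 (B x).2 (l x)).prod
          ((List.ofFn fun x => a (J x) (p x)).prod ψ))
    (Continuous fun x : (Fin r → ℝ) × (Fin t → ℝ) × (Fin s → ℝ) => M x.1 x.2.1 x.2.2) ∧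
      ∀ m : ℕ, ∃ (C : ℝ) (d : ℕ), ∀ k l p,
        (1 + ‖k‖ + ‖p‖) ^ m * ‖M k l p‖ ≤ C * (1 + ‖l‖) ^ d
  /-- `a_{i₁}(k₁) a_{i₂}(k₂) = R_{i₂ i₁}^{j₁ j₂}(k₂, k₁) a_{j₂}(k₂) a_{j₁}(k₁)`. -/
  exchange_aa : ∀ i₁ i₂ k₁ k₂,
    a i₁ k₁ * a i₂ k₂ =
      ∑ j₁, ∑ j₂, R k₂ k₁ (i₂, i₁) (j₁, j₂) • (a j₂ k₂ * a j₁ k₁)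
  /-- `a*^{i₁}(k₁) a*^{i₂}(k₂) = a*^{j₂}(k₂) a*^{j₁}(k₁) R_{j₂ j₁}^{i₁ i₂}(k₂, k₁)`. -/
  exchange_aStar_aStar : ∀ i₁ i₂ k₁ k₂ φ ψ,
    pair (aStarBra i₂ k₂ (aStarBra i₁ k₁ φ)) ψ =
      ∑ j₁, ∑ j₂, R k₂ k₁ (j₂, j₁) (i₁, i₂) * pair (aStarBra j₁ k₁ (aStarBra j₂ k₂ φ)) ψ
  /-- `a_{i₁}(k₁) a*^{i₂}(k₂) = a*^{j₂}(k₂) R_{i₁ j₂}^{i₂ j₁}(k₁, k₂) a_{j₁}(k₁)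
  + 2π δ(k₁ - k₂) δ_{i₁}^{i₂} 1 + 2π δ(k₁ + k₂) b_{i₁}^{i₂}(k₁)`, as an identity of distributions,
  smeared with `f(k₁) g(k₂)`. -/
  exchange_a_aStar : ∀ (i₁ i₂ : Fin N) (f g : MomentumTest) (φ : W) (ψ : V),
    pair (aSmearedBra i₁ f φ) (aStarSmeared i₂ g ψ) =
      (∫ k : ℝ × ℝ, f k.1 * g k.2 *
        ∑ j₁, ∑ j₂, R k.1 k.2 (i₁, j₂) (i₂, j₁) * pair (aStarBra j₂ k.2 φ) (a j₁ k.1 ψ))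
      + 2 * Real.pi * (∫ k : ℝ, f k * g k) * (if i₁ = i₂ then pair φ ψ else 0)
      + 2 * Real.pi * ∫ k : ℝ, f k * g (-k) * pair φ (b i₁ i₂ k ψ)
  /-- `R_{i₁ i₂}^{l₂ l₁}(k₁, k₂) b_{l₁}^{m₁}(k₁) R_{l₂ m₁}^{j₁ m₂}(k₂, -k₁) b_{m₂}^{j₂}(k₂)
  = b_{i₂}^{l₂}(k₂) R_{i₁ l₂}^{m₂ m₁}(k₁, -k₂) b_{m₁}^{l₁}(k₁) R_{m₂ l₁}^{j₁ j₂}(-k₂, -k₁)`. -/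
  exchange_bb : ∀ i₁ i₂ j₁ j₂ k₁ k₂,
    ∑ l₁, ∑ l₂, ∑ m₁, ∑ m₂,
      (R k₁ k₂ (i₁, i₂) (l₂, l₁) * R k₂ (-k₁) (l₂, m₁) (j₁, m₂)) • (b l₁ m₁ k₁ * b m₂ j₂ k₂) =
    ∑ l₁, ∑ l₂, ∑ m₁, ∑ m₂,
      (R k₁ (-k₂) (i₁, l₂) (m₂, m₁) * R (-k₂) (-k₁) (m₂, l₁) (j₁, j₂)) •
        (b i₂ l₂ k₂ * b m₁ l₁ k₁)
  /-- `a_{i₁}(k₁) b_{i₂}^{j₂}(k₂)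
  = R_{i₂ i₁}^{l₁ l₂}(k₂, k₁) b_{l₂}^{m₂}(k₂) R_{l₁ m₂}^{j₂ m₁}(k₁, -k₂) a_{m₁}(k₁)`. -/
  exchange_ab : ∀ i₁ i₂ j₂ k₁ k₂,
    a i₁ k₁ * b i₂ j₂ k₂ =
      ∑ l₁, ∑ l₂, ∑ m₁, ∑ m₂,
        (R k₂ k₁ (i₂, i₁) (l₁, l₂) * R k₁ (-k₂) (l₁, m₂) (j₂, m₁)) • (b l₂ m₂ k₂ * a m₁ k₁)
  /-- `b_{i₁}^{j₁}(k₁) a*^{i₂}(k₂)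
  = a*^{m₂}(k₂) R_{i₁ m₂}^{l₂ m₁}(k₁, k₂) b_{m₁}^{l₁}(k₁) R_{l₂ l₁}^{j₁ i₂}(k₂, -k₁)`. -/
  exchange_b_aStar : ∀ i₁ j₁ i₂ k₁ k₂ φ ψ,
    pair (aStarBra i₂ k₂ (bBra i₁ j₁ k₁ φ)) ψ =
      ∑ l₁, ∑ l₂, ∑ m₁, ∑ m₂,
        R k₁ k₂ (i₁, m₂) (l₂, m₁) * R k₂ (-k₁) (l₂, l₁) (j₁, i₂) *
          pair (aStarBra m₂ k₂ φ) (b m₁ l₁ k₁ ψ)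

namespace BoundaryRep

variable {N : ℕ} {R : ExchangeFactor N} {V W : Type*}
  [AddCommGroup V] [Module ℂ V] [AddCommGroup W] [Module ℂ W]

/-- `T = ∫ pⁿ a*^i(p) a_i(p) dp` as an operator on the domain `V` (weak integral). -/
def IsHamiltonian (ρ : BoundaryRep R V W) (n : ℕ) (T : Module.End ℂ V) : Prop :=
  ∀ (φ : W) (ψ : V),
    Integrable (fun p : ℝ => (p : ℂ) ^ n * ∑ i, ρ.pair (ρ.aStarBra i p φ) (ρ.a i p ψ)) ∧
    ρ.pair φ (T ψ) =
      ∫ p : ℝ, (p : ℂ) ^ n * ∑ i, ρ.pair (ρ.aStarBra i p φ) (ρ.a i p ψ)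

/-- The matrix element `⟨φ| a*^i(-p) b_i^j(-p) a_j(p) |ψ⟩`, summed over `i` and `j`. -/
def reflectedDensity (ρ : BoundaryRep R V W) (φ : W) (ψ : V) (p : ℝ) : ℂ :=
  ∑ i, ∑ j, ρ.pair (ρ.aStarBra i (-p) φ) (ρ.b i j (-p) (ρ.a j p ψ))

/-- The algebra generated by the boundary generators `b_i^j(k)`. -/
def boundarySubalgebra (ρ : BoundaryRep R V W) : Subalgebra ℂ (Module.End ℂ V) :=
  Algebra.adjoin ℂ {T | ∃ i j k, T = ρ.b i j k}

/-- A Fock representation of the reflection algebra with its involution, on a dense invariant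
domain `D` of a Hilbert space (the completion of `D`): the pairing is the scalar product, the
involution `a*^i(k) ↔ a_i(k)`, `b_i^j(k) ↦ b_j^i(-k)` is realized as conjugation, the constraint
`b_i^l(k) b_l^j(-k) = δ_i^j` holds, and `Ω` is a normalized vacuum, cyclic for the `a*^i`. -/
structure IsFock {D : Type*} [NormedAddCommGroup D] [InnerProductSpace ℂ D]
    (ρ : BoundaryRep R D D) (Ω : D) : Prop where
  pair_eq_inner : ∀ φ ψ : D, ρ.pair φ ψ = inner ℂ φ ψ
  aStar_adjoint : ∀ i k, ρ.aStarBra i k = ρ.a i k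
  b_adjoint : ∀ i j k, ρ.bBra i j k = ρ.b j i (-k)
  reflection : ∀ i j k, ∑ l, ρ.b i l k * ρ.b l j (-k) = if i = j then 1 else 0
  vacuum : ∀ i k, ρ.a i k Ω = 0
  norm_vacuum : ‖Ω‖ = 1
  cyclic : Dense (Submodule.span ℂ
    {ψ : D | ∃ L : List (Fin N × MomentumTest),
      ψ = (L.map fun x => ρ.aStarSmeared x.1 x.2).prod Ω} : Set D)

end BoundaryRep

end

/-!
All statements about a general representation follow from the exchange relations between matrix
elements, once the relation of `a` with `a*`, which is given only after smearing with two test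
functions, is known with one momentum left pointwise.  Since matrix elements are continuous, two of
them which agree as distributions agree pointwise, and this gives `pair_aStarBra_aSmearedBra` and
`pair_a_aStarSmeared`.

* The density `a*^i(p) a_i(p)` commutes with every `b_i^j(k)` (`density_comm_b`), hence so does
  `H_n`.
* Inserting the half-smeared relation into `H_m = ∫ qᵐ a*^j(q) a_j(q) dq` yields
  `[a_i(k), H_m] = 2π kᵐ a_i(k) + 2π (-k)ᵐ b_i^j(k) a_j(-k)` (`a_hamiltonian`).  In the product
  `H_n H_m` this leaves a normal ordered double integral and a single one over `a*^i(p) a_i(p)`,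
  both symmetric in `n` and `m`, and an integral of the reflected density with the sign `(-1)ⁿ`
  (`hamiltonian_mul_hamiltonian`).  The commutator is the difference of the reflected terms.
* In a Fock representation the vectors created from the vacuum satisfy the boundary condition
  `a_i(k) = b_i^j(k) a_j(-k)` (`IsFock.a_eq_b_a`): it holds on the vacuum and is preserved by
  creation operators, since the contact terms cancel by `b(k) b(-k) = 1`.  As `b(k)` is unitary,
  the density of `H_n` is even in the momentum, so that odd Hamiltonians have vanishing matrix
  elements between these vectors; being symmetric, they vanish on the whole domain.
* Hamiltonians of opposite parity fail to commute for free bosons (the exchange factor is the flip)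
  with boundary generators `b_i^j(k) = c δ_i^j`, `0 < |c| < 1`.  This representation is built on the
  polynomial algebra over compactly supported one-particle functions: creation is multiplication,
  annihilation is a derivation, and the null vectors of the resulting pairing are divided out.
-/

noncomputable section

/-! ### Test functions and parametric integrals -/

/-- The fundamental lemma of the calculus of variations: two continuous functions which agree as
distributions agree pointwise. -/
theorem eq_of_forall_integral_momentumTest_mul_eq {F G : ℝ → ℂ} (hF : Continuous F)
    (hG : Continuous G)
    (h : ∀ f : MomentumTest, ∫ k, f k * F k = ∫ k, f k * G k) : F = G := by
  have key : ∀ᵐ x : ℝ, F x = G x := by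
    refine ae_eq_of_integral_contDiff_smul_eq hF.locallyIntegrable hG.locallyIntegrable ?_
    intro g hg hgs
    have := h ⟨fun x => (g x : ℂ), Complex.ofRealCLM.contDiff.comp hg,
      hgs.comp_left (g := fun x : ℝ => (x : ℂ)) Complex.ofReal_zero, by simp⟩
    simp only [Complex.real_smul]
    exact this
  exact (hF.ae_eq_iff_eq volume hG).mp key

theorem integrable_momentumTest_mul (f : MomentumTest) {F : ℝ → ℂ} (hF : Continuous F) :
    Integrable fun k => f k * F k :=
  (f.continuous.mul hF).integrable_of_hasCompactSupport f.hasCompactSupport.mul_right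

theorem continuous_integral_momentumTest_mul (f : MomentumTest) {K : ℝ → ℝ → ℂ}
    (hK : Continuous fun x : ℝ × ℝ => K x.1 x.2) :
    Continuous fun q => ∫ k, f k * K q k := by
  have h := continuous_parametric_integral_of_continuous (μ := volume)
    (f := fun q k => f k * K q k)
    (by exact (f.continuous.comp continuous_snd).mul hK) (s := tsupport f) f.hasCompactSupport
  refine h.congr fun q => setIntegral_eq_integral_of_forall_compl_eq_zero fun x hx => ?_
  rw [image_eq_zero_of_notMem_tsupport hx, zero_mul]

/-- The reflected test function `k ↦ f (-k)`. -/
def MomentumTest.reflect (f : MomentumTest) : MomentumTest :=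
  ⟨fun k => f (-k), f.contDiff.comp contDiff_neg,
    f.hasCompactSupport.comp_homeomorph (Homeomorph.neg ℝ), by simp⟩

@[simp]
theorem MomentumTest.reflect_apply (f : MomentumTest) (k : ℝ) : f.reflect k = f (-k) := rfl

theorem integrable_momentumTest_prod (f g : MomentumTest) {K : ℝ → ℝ → ℂ}
    (hK : Continuous fun x : ℝ × ℝ => K x.1 x.2) :
    Integrable fun k : ℝ × ℝ => f k.1 * g k.2 * K k.1 k.2 := by
  refine Continuous.integrable_of_hasCompactSupport ?_ ?_
  · exact ((f.continuous.comp continuous_fst).mul (g.continuous.comp continuous_snd)).mul hK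
  · refine HasCompactSupport.mul_right ?_
    refine HasCompactSupport.of_support_subset_isCompact
      (f.hasCompactSupport.isCompact.prod g.hasCompactSupport.isCompact) ?_
    intro x hx
    simp only [Function.mem_support, ne_eq, mul_eq_zero, not_or] at hx
    exact ⟨subset_tsupport _ hx.1, subset_tsupport _ hx.2⟩

theorem integral_momentumTest_prod_fst (f g : MomentumTest) {K : ℝ → ℝ → ℂ}
    (hK : Continuous fun x : ℝ × ℝ => K x.1 x.2) :
    ∫ k : ℝ × ℝ, f k.1 * g k.2 * K k.1 k.2 = ∫ k, f k * ∫ q, g q * K k q := by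
  rw [Measure.volume_eq_prod, integral_prod _ (integrable_momentumTest_prod f g hK)]
  simp_rw [mul_assoc, integral_const_mul]

theorem integral_momentumTest_prod_snd (f g : MomentumTest) {K : ℝ → ℝ → ℂ}
    (hK : Continuous fun x : ℝ × ℝ => K x.1 x.2) :
    ∫ k : ℝ × ℝ, f k.1 * g k.2 * K k.1 k.2 = ∫ q, g q * ∫ k, f k * K k q := by
  rw [Measure.volume_eq_prod, integral_prod_symm _ (integrable_momentumTest_prod f g hK)]
  simp_rw [← integral_const_mul]
  congr 1; ext q; congr 1; ext k; ring

/-- Two extra powers of decay make a weight `xⁿ` integrable. -/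
theorem norm_pow_mul_le_of_one_add_pow_mul_le {C x y : ℝ} {n : ℕ} (hx : 0 ≤ x) (hy : 0 ≤ y)
    (h : (1 + x) ^ (n + 2) * y ≤ C) : x ^ n * y ≤ C * (1 + x ^ 2)⁻¹ := by
  rw [← div_eq_mul_inv, le_div_iff₀ (by positivity)]
  refine le_trans ?_ h
  have h1 : x ^ n ≤ (1 + x) ^ n := by gcongr; linarith
  have h2 : 1 + x ^ 2 ≤ (1 + x) ^ 2 := by nlinarith
  calc x ^ n * y * (1 + x ^ 2) = (x ^ n * (1 + x ^ 2)) * y := by ring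
    _ ≤ ((1 + x) ^ n * (1 + x) ^ 2) * y := by gcongr
    _ = _ := by ring

namespace BoundaryRep

variable {N : ℕ} {R : ExchangeFactor N} {V W : Type*}
  [AddCommGroup V] [Module ℂ V] [AddCommGroup W] [Module ℂ W]

/-! ### Regularity of matrix elements with few operators -/

theorem continuous_aStar (ρ : BoundaryRep R V W) (i : Fin N) (φ : W) (ψ : V) :
    Continuous fun q => ρ.pair (ρ.aStarBra i q φ) ψ := by
  have h := (ρ.regular 1 0 0 ![i] ![] ![] φ ψ).1
  simp only [List.ofFn_succ, List.ofFn_zero, List.reverse_cons, List.reverse_nil, List.nil_append,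
    List.prod_cons, List.prod_nil, mul_one, Matrix.cons_val_zero, Module.End.one_apply] at h
  exact h.comp (f := fun q : ℝ => ((fun _ => q, ![], ![]) :
    (Fin 1 → ℝ) × (Fin 0 → ℝ) × (Fin 0 → ℝ))) (by fun_prop)

theorem continuous_a (ρ : BoundaryRep R V W) (i : Fin N) (φ : W) (ψ : V) :
    Continuous fun k => ρ.pair φ (ρ.a i k ψ) := by
  have h := (ρ.regular 0 0 1 ![] ![] ![i] φ ψ).1
  simp only [List.ofFn_succ, List.ofFn_zero, List.reverse_nil,
    List.prod_cons, List.prod_nil, mul_one, Matrix.cons_val_zero, Module.End.one_apply] at h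
  exact h.comp (f := fun q : ℝ => ((![], ![], fun _ => q) :
    (Fin 0 → ℝ) × (Fin 0 → ℝ) × (Fin 1 → ℝ))) (by fun_prop)

theorem continuous_b (ρ : BoundaryRep R V W) (i j : Fin N) (φ : W) (ψ : V) :
    Continuous fun k => ρ.pair φ (ρ.b i j k ψ) := by
  have h := (ρ.regular 0 1 0 ![] ![(i, j)] ![] φ ψ).1
  simp only [List.ofFn_succ, List.ofFn_zero, List.reverse_nil,
    List.prod_cons, List.prod_nil, mul_one, Matrix.cons_val_zero, Module.End.one_apply] at h
  exact h.comp (f := fun q : ℝ => ((![], fun _ => q, ![]) :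
    (Fin 0 → ℝ) × (Fin 1 → ℝ) × (Fin 0 → ℝ))) (by fun_prop)

theorem continuous_b_a (ρ : BoundaryRep R V W) (i j l : Fin N) (φ : W) (ψ : V) :
    Continuous fun k : ℝ × ℝ => ρ.pair φ (ρ.b i j k.1 (ρ.a l k.2 ψ)) := by
  have h := (ρ.regular 0 1 1 ![] ![(i, j)] ![l] φ ψ).1
  simp only [List.ofFn_succ, List.ofFn_zero, List.reverse_nil,
    List.prod_cons, List.prod_nil, mul_one, Matrix.cons_val_zero, Module.End.one_apply] at h
  exact h.comp (f := fun k : ℝ × ℝ => ((![], fun _ => k.1, fun _ => k.2) :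
    (Fin 0 → ℝ) × (Fin 1 → ℝ) × (Fin 1 → ℝ))) (by fun_prop)

/-- Matrix elements `⟨φ| a*^i(k) a_j(p) |ψ⟩` are jointly continuous and decrease rapidly. -/
theorem regular_aStar_a (ρ : BoundaryRep R V W) (i j : Fin N) (φ : W) (ψ : V) :
    (Continuous fun k : ℝ × ℝ => ρ.pair (ρ.aStarBra i k.1 φ) (ρ.a j k.2 ψ)) ∧
    ∀ m : ℕ, ∃ C : ℝ, ∀ k p : ℝ,
      (1 + |k|) ^ m * ‖ρ.pair (ρ.aStarBra i k φ) (ρ.a j p ψ)‖ ≤ C := by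
  have h := ρ.regular 1 0 1 ![i] ![] ![j] φ ψ
  simp only [List.ofFn_succ, List.ofFn_zero, List.reverse_cons, List.reverse_nil, List.nil_append,
    List.prod_cons, List.prod_nil, mul_one, Matrix.cons_val_zero, Module.End.one_apply] at h
  obtain ⟨hc, hb⟩ := h
  constructor
  · exact hc.comp (f := fun k : ℝ × ℝ => ((fun _ => k.1, ![], fun _ => k.2) :
      (Fin 1 → ℝ) × (Fin 0 → ℝ) × (Fin 1 → ℝ))) (by fun_prop)
  · intro m
    obtain ⟨C, d, hC⟩ := hb m
    refine ⟨C, fun k p => ?_⟩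
    have h1 := hC (fun _ => k) ![] (fun _ => p)
    have h0 : ‖(![] : Fin 0 → ℝ)‖ = 0 := by simp [Pi.norm_def]
    rw [h0, add_zero, one_pow, mul_one] at h1
    refine le_trans ?_ h1
    have h2 : |k| ≤ ‖(fun _ => k : Fin 1 → ℝ)‖ := norm_le_pi_norm (fun _ => k : Fin 1 → ℝ) 0
    have h3 := norm_nonneg (fun _ => p : Fin 1 → ℝ)
    gcongr ?_ ^ m * ?_
    linarith

/-- Matrix elements `⟨φ| a*^i(q) a_j(q') a_l(k) |ψ⟩` are jointly continuous, and decrease rapidly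
in `q` uniformly in the other momenta. -/
theorem regular_aStar_a_a (ρ : BoundaryRep R V W) (i j l : Fin N) (φ : W) (ψ : V) :
    (Continuous fun x : ℝ × ℝ × ℝ =>
      ρ.pair (ρ.aStarBra i x.1 φ) (ρ.a j x.2.1 (ρ.a l x.2.2 ψ))) ∧
    ∀ m : ℕ, ∃ C : ℝ, ∀ q q' k : ℝ,
      (1 + |q|) ^ m * ‖ρ.pair (ρ.aStarBra i q φ) (ρ.a j q' (ρ.a l k ψ))‖ ≤ C := by
  have h := ρ.regular 1 0 2 ![i] ![] ![j, l] φ ψ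
  simp only [List.ofFn_succ, List.ofFn_zero, List.reverse_cons, List.reverse_nil, List.nil_append,
    List.prod_cons, List.prod_nil, mul_one, Matrix.cons_val_zero, Module.End.one_apply,
    Module.End.mul_apply, Matrix.cons_val_succ, Matrix.cons_val_zero] at h
  obtain ⟨hc, hb⟩ := h
  constructor
  · exact hc.comp (f := fun x : ℝ × ℝ × ℝ => ((fun _ => x.1, ![], ![x.2.1, x.2.2]) :
      (Fin 1 → ℝ) × (Fin 0 → ℝ) × (Fin 2 → ℝ))) (by fun_prop)
  · intro m
    obtain ⟨C, d, hC⟩ := hb m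
    refine ⟨C, fun q q' k => ?_⟩
    have h1 := hC (fun _ => q) ![] ![q', k]
    have h0 : ‖(![] : Fin 0 → ℝ)‖ = 0 := by simp [Pi.norm_def]
    rw [h0, add_zero, one_pow, mul_one] at h1
    refine le_trans ?_ h1
    have h2 : |q| ≤ ‖(fun _ => q : Fin 1 → ℝ)‖ := norm_le_pi_norm (fun _ => q : Fin 1 → ℝ) 0
    gcongr ?_ ^ m * ?_
    · have := norm_nonneg ![q', k]
      linarith
    · exact le_rfl

/-- Matrix elements `⟨φ| a*^i(p) a*^j(q) a_l(q) a_m(p) |ψ⟩` are jointly continuous and decrease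
rapidly in both momenta. -/
theorem regular_aStar_aStar_a_a (ρ : BoundaryRep R V W) (i j l m : Fin N) (φ : W) (ψ : V) :
    (Continuous fun x : ℝ × ℝ =>
      ρ.pair (ρ.aStarBra j x.2 (ρ.aStarBra i x.1 φ)) (ρ.a l x.2 (ρ.a m x.1 ψ))) ∧
    ∀ n n' : ℕ, ∃ C : ℝ, ∀ p q : ℝ,
      (1 + |p|) ^ n * (1 + |q|) ^ n' *
        ‖ρ.pair (ρ.aStarBra j q (ρ.aStarBra i p φ)) (ρ.a l q (ρ.a m p ψ))‖ ≤ C := by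
  have h := ρ.regular 2 0 2 ![i, j] ![] ![l, m] φ ψ
  simp only [List.ofFn_succ, List.ofFn_zero, List.reverse_cons, List.reverse_nil, List.nil_append,
    List.prod_cons, List.prod_nil, mul_one, Matrix.cons_val_zero, Module.End.one_apply,
    Module.End.mul_apply, Matrix.cons_val_succ, Matrix.cons_val_zero, List.cons_append] at h
  obtain ⟨hc, hb⟩ := h
  constructor
  · exact hc.comp (f := fun x : ℝ × ℝ => ((![x.1, x.2], ![], ![x.2, x.1]) :
      (Fin 2 → ℝ) × (Fin 0 → ℝ) × (Fin 2 → ℝ))) (by fun_prop)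
  · intro n n'
    obtain ⟨C, d, hC⟩ := hb (n + n')
    refine ⟨C, fun p q => ?_⟩
    have h1 := hC ![p, q] ![] ![q, p]
    have h0 : ‖(![] : Fin 0 → ℝ)‖ = 0 := by simp [Pi.norm_def]
    rw [h0, add_zero, one_pow, mul_one] at h1
    refine le_trans ?_ h1
    have h2 : |p| ≤ ‖![p, q]‖ := norm_le_pi_norm ![p, q] 0
    have h3 : |q| ≤ ‖![p, q]‖ := norm_le_pi_norm ![p, q] 1
    have h4 := norm_nonneg ![q, p]
    rw [pow_add]
    gcongr ?_ ^ n * ?_ ^ n' * ?_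
    · linarith
    · linarith
    · exact le_rfl

end BoundaryRep

namespace BoundaryRep

variable {N : ℕ} {R : ExchangeFactor N} {V W : Type*}
  [AddCommGroup V] [Module ℂ V] [AddCommGroup W] [Module ℂ W]

theorem ext_pair (ρ : BoundaryRep R V W) {ψ ψ' : V} (h : ∀ φ, ρ.pair φ ψ = ρ.pair φ ψ') :
    ψ = ψ' := by
  rw [← sub_eq_zero]
  exact ρ.pair_separates _ fun φ => by rw [map_sub, h, sub_self]

/-! ### Hamiltonians commute with the boundary generators -/

theorem a_b_apply (ρ : BoundaryRep R V W) (i₁ i₂ j₂ : Fin N) (k₁ k₂ : ℝ) (ψ : V) :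
    ρ.a i₁ k₁ (ρ.b i₂ j₂ k₂ ψ) =
      ∑ l₁, ∑ l₂, ∑ m₁, ∑ m₂,
        (R k₂ k₁ (i₂, i₁) (l₁, l₂) * R k₁ (-k₂) (l₁, m₂) (j₂, m₁)) •
          ρ.b l₂ m₂ k₂ (ρ.a m₁ k₁ ψ) := by
  have h := LinearMap.congr_fun (ρ.exchange_ab i₁ i₂ j₂ k₁ k₂) ψ
  simpa only [Module.End.mul_apply, LinearMap.sum_apply, LinearMap.smul_apply] using h

theorem a_a_apply (ρ : BoundaryRep R V W) (i₁ i₂ : Fin N) (k₁ k₂ : ℝ) (ψ : V) :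
    ρ.a i₁ k₁ (ρ.a i₂ k₂ ψ) =
      ∑ j₁, ∑ j₂, R k₂ k₁ (i₂, i₁) (j₁, j₂) • ρ.a j₂ k₂ (ρ.a j₁ k₁ ψ) := by
  have h := LinearMap.congr_fun (ρ.exchange_aa i₁ i₂ k₁ k₂) ψ
  simpa only [Module.End.mul_apply, LinearMap.sum_apply, LinearMap.smul_apply] using h

/-- The bulk density `a*^i(p) a_i(p)` commutes with `b_i^j(k)`: moving `b` through `a` to the left
and through `a*` to the right produces the same products of exchange factors. -/
theorem density_comm_b (ρ : BoundaryRep R V W) (i j : Fin N) (k p : ℝ) (φ : W) (ψ : V) :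
    ∑ l, ρ.pair (ρ.aStarBra l p φ) (ρ.a l p (ρ.b i j k ψ)) =
      ∑ l, ρ.pair (ρ.aStarBra l p (ρ.bBra i j k φ)) (ρ.a l p ψ) := by
  simp only [ρ.a_b_apply, ρ.exchange_b_aStar, map_sum, map_smul, smul_eq_mul]
  simp only [Finset.sum_sigma']
  exact Finset.sum_bij'
    (fun x _ => ⟨x.2.2.2.1, x.2.2.2.2, x.2.1, x.2.2.1, x.1⟩)
    (fun x _ => ⟨x.2.2.2.2, x.2.2.1, x.2.2.2.1, x.1, x.2.1⟩)
    (by simp) (by simp) (by simp) (by simp) (by simp)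

theorem lie_hamiltonian_b (ρ : BoundaryRep R V W) {n : ℕ} {T : Module.End ℂ V}
    (hT : ρ.IsHamiltonian n T) (i j : Fin N) (k : ℝ) : ⁅T, ρ.b i j k⁆ = 0 := by
  rw [Ring.lie_def, sub_eq_zero]
  ext ψ
  refine ρ.ext_pair fun φ => ?_
  rw [Module.End.mul_apply, Module.End.mul_apply, ← ρ.pair_bBra, (hT _ _).2, (hT _ _).2]
  simp only [ρ.density_comm_b]

theorem lie_hamiltonian_of_mem_boundarySubalgebra (ρ : BoundaryRep R V W) {n : ℕ}
    {T : Module.End ℂ V} (hT : ρ.IsHamiltonian n T) {X : Module.End ℂ V}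
    (hX : X ∈ ρ.boundarySubalgebra) : ⁅T, X⁆ = 0 := by
  have hle : ρ.boundarySubalgebra ≤ Subalgebra.centralizer ℂ {T} := by
    refine Algebra.adjoin_le ?_
    rintro _ ⟨i, j, k, rfl⟩
    rw [SetLike.mem_coe, Subalgebra.mem_centralizer_iff]
    rintro _ rfl
    exact sub_eq_zero.mp (ρ.lie_hamiltonian_b hT i j k)
  rw [Ring.lie_def, sub_eq_zero]
  exact (Subalgebra.mem_centralizer_iff ℂ).mp (hle hX) T rfl

/-! ### The relation between creation and annihilation operators, smeared in one momentum -/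

/-- The matrix element `⟨φ| a*^{j₂}(q) R_{i j₂}^{j j₁}(k, q) a_{j₁}(k) |ψ⟩` of the normal ordered
term of `a_i(k) a*^j(q)`. -/
def exchangeKernel (ρ : BoundaryRep R V W) (i j : Fin N) (φ : W) (ψ : V) (k q : ℝ) : ℂ :=
  ∑ j₁, ∑ j₂, R k q (i, j₂) (j, j₁) * ρ.pair (ρ.aStarBra j₂ q φ) (ρ.a j₁ k ψ)

theorem continuous_exchangeKernel (hR : IsExchangeFactor R) (ρ : BoundaryRep R V W) (i j : Fin N)
    (φ : W) (ψ : V) :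
    Continuous fun x : ℝ × ℝ => ρ.exchangeKernel i j φ ψ x.1 x.2 := by
  unfold exchangeKernel
  refine continuous_finsetSum _ fun j₁ _ => continuous_finsetSum _ fun j₂ _ => ?_
  exact (hR.continuous.matrix_elem _ _).mul
    ((ρ.regular_aStar_a j₂ j₁ φ ψ).1.comp continuous_swap)

/-- The exchange relation of `a_i(f)` and `a*^j(q)`, smeared in the momentum of `a` only. -/
theorem pair_aStarBra_aSmearedBra (hR : IsExchangeFactor R) (ρ : BoundaryRep R V W) (i j : Fin N)
    (f : MomentumTest) (q : ℝ) (φ : W) (ψ : V) :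
    ρ.pair (ρ.aStarBra j q (ρ.aSmearedBra i f φ)) ψ =
      (∫ k, f k * ρ.exchangeKernel i j φ ψ k q)
      + f q * (2 * Real.pi * (if i = j then ρ.pair φ ψ else 0))
      + f (-q) * (2 * Real.pi * ρ.pair φ (ρ.b i j (-q) ψ)) := by
  have hK := ρ.continuous_exchangeKernel hR i j φ ψ
  have hK' : Continuous fun q => ∫ k, f k * ρ.exchangeKernel i j φ ψ k q :=
    continuous_integral_momentumTest_mul f (K := fun q k => ρ.exchangeKernel i j φ ψ k q)
      (hK.comp continuous_swap)
  have hb : Continuous fun q => ρ.pair φ (ρ.b i j (-q) ψ) :=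
    (ρ.continuous_b i j φ ψ).comp continuous_neg
  have hf := f.continuous
  have hf' : Continuous fun q => f (-q) := hf.comp continuous_neg
  refine congrFun (eq_of_forall_integral_momentumTest_mul_eq
    (F := fun q => ρ.pair (ρ.aStarBra j q (ρ.aSmearedBra i f φ)) ψ)
    (G := fun q => (∫ k, f k * ρ.exchangeKernel i j φ ψ k q)
      + f q * (2 * Real.pi * (if i = j then ρ.pair φ ψ else 0))
      + f (-q) * (2 * Real.pi * ρ.pair φ (ρ.b i j (-q) ψ)))
    (ρ.continuous_aStar j _ ψ) (by fun_prop) fun g => ?_) q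
  rw [← ρ.pair_aStarSmeared, ρ.exchange_a_aStar]
  have e := integral_momentumTest_prod_snd f g hK
  simp only [exchangeKernel] at e ⊢
  rw [e]
  simp only [mul_add]
  rw [integral_add, integral_add]
  · congr 1
    · congr 1
      rw [mul_comm (2 * Real.pi : ℂ), mul_assoc, ← integral_mul_const]
      congr 1; ext k; ring
    · rw [← integral_neg_eq_self, ← integral_const_mul]
      congr 1; ext k; rw [neg_neg]; ring
  · exact integrable_momentumTest_mul g hK'
  · exact integrable_momentumTest_mul g (by fun_prop)
  · exact (integrable_momentumTest_mul g hK').add (integrable_momentumTest_mul g (by fun_prop))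
  · exact integrable_momentumTest_mul g (by fun_prop)

/-- The exchange relation of `a_i(k)` and `a*^j(g)`, smeared in the momentum of `a*` only. -/
theorem pair_a_aStarSmeared (hR : IsExchangeFactor R) (ρ : BoundaryRep R V W) (i j : Fin N)
    (g : MomentumTest) (k : ℝ) (φ : W) (ψ : V) :
    ρ.pair φ (ρ.a i k (ρ.aStarSmeared j g ψ)) =
      (∫ q, g q * ρ.exchangeKernel i j φ ψ k q)
      + g k * (2 * Real.pi * (if i = j then ρ.pair φ ψ else 0))
      + g (-k) * (2 * Real.pi * ρ.pair φ (ρ.b i j k ψ)) := by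
  have hK := ρ.continuous_exchangeKernel hR i j φ ψ
  have hK' : Continuous fun k => ∫ q, g q * ρ.exchangeKernel i j φ ψ k q :=
    continuous_integral_momentumTest_mul g hK
  have hb : Continuous fun k => ρ.pair φ (ρ.b i j k ψ) := ρ.continuous_b i j φ ψ
  have hg := g.continuous
  have hg' : Continuous fun q => g (-q) := hg.comp continuous_neg
  refine congrFun (eq_of_forall_integral_momentumTest_mul_eq
    (F := fun k => ρ.pair φ (ρ.a i k (ρ.aStarSmeared j g ψ)))
    (G := fun k => (∫ q, g q * ρ.exchangeKernel i j φ ψ k q)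
      + g k * (2 * Real.pi * (if i = j then ρ.pair φ ψ else 0))
      + g (-k) * (2 * Real.pi * ρ.pair φ (ρ.b i j k ψ)))
    (ρ.continuous_a i φ _) (by fun_prop) fun f => ?_) k
  rw [← ρ.pair_aSmearedBra, ρ.exchange_a_aStar]
  have e := integral_momentumTest_prod_fst f g hK
  simp only [exchangeKernel] at e ⊢
  rw [e]
  simp only [mul_add]
  rw [integral_add, integral_add]
  · congr 1
    · congr 1
      rw [mul_comm (2 * Real.pi : ℂ), mul_assoc, ← integral_mul_const]
      congr 1; ext k; ring
    · rw [← integral_const_mul]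
      congr 1; ext k; ring
  · exact integrable_momentumTest_mul f hK'
  · exact integrable_momentumTest_mul f (by fun_prop)
  · exact (integrable_momentumTest_mul f hK').add (integrable_momentumTest_mul f (by fun_prop))
  · exact integrable_momentumTest_mul f (by fun_prop)

/-! ### Commutators of annihilation operators with Hamiltonians -/

/-- By the exchange relation of `a` with itself, the normal ordered terms of `a_i(k) a*^j(q)`
applied to `a_j(q) ψ` add up to the bulk density between `φ` and `a_i(k) ψ`. -/
theorem sum_exchangeKernel_a (ρ : BoundaryRep R V W) (i : Fin N) (k q : ℝ) (φ : W) (ψ : V) :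
    ∑ j, ρ.exchangeKernel i j φ (ρ.a j q ψ) k q =
      ∑ j, ρ.pair (ρ.aStarBra j q φ) (ρ.a j q (ρ.a i k ψ)) := by
  simp only [exchangeKernel, fun j => ρ.a_a_apply j i q k ψ, map_sum, map_smul, smul_eq_mul]
  calc _ = ∑ j, ∑ j₂, ∑ j₁, R k q (i, j₂) (j, j₁) *
        ρ.pair (ρ.aStarBra j₂ q φ) (ρ.a j₁ k (ρ.a j q ψ)) :=
        Finset.sum_congr rfl fun j _ => Finset.sum_comm
    _ = _ := Finset.sum_comm

/-- The integrand of `⟨φ| H_m a_i(k) |ψ⟩` is dominated uniformly in `k`. -/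
theorem norm_pow_mul_density_le (ρ : BoundaryRep R V W) (m : ℕ) (i : Fin N) (φ : W) (ψ : V) :
    ∃ C : ℝ, ∀ q k : ℝ, ‖(q : ℂ) ^ m * ∑ j, ρ.pair (ρ.aStarBra j q φ) (ρ.a j q (ρ.a i k ψ))‖ ≤
      C * (1 + q ^ 2)⁻¹ := by
  choose C hC using fun j => (ρ.regular_aStar_a_a j j i φ ψ).2 (m + 2)
  refine ⟨∑ j, C j, fun q k => ?_⟩
  rw [Finset.mul_sum, Finset.sum_mul]
  refine (norm_sum_le _ _).trans (Finset.sum_le_sum fun j _ => ?_)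
  rw [norm_mul, norm_pow, Complex.norm_real, Real.norm_eq_abs, ← sq_abs q]
  exact norm_pow_mul_le_of_one_add_pow_mul_le (abs_nonneg q) (norm_nonneg _) (hC j q q k)

theorem continuous_density (ρ : BoundaryRep R V W) (i : Fin N) (φ : W) (ψ : V) :
    Continuous fun x : ℝ × ℝ =>
      ∑ j, ρ.pair (ρ.aStarBra j x.1 φ) (ρ.a j x.1 (ρ.a i x.2 ψ)) :=
  continuous_finsetSum _ fun j _ => (ρ.regular_aStar_a_a j j i φ ψ).1.comp
    (f := fun x : ℝ × ℝ => (x.1, x.1, x.2)) (by fun_prop)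

/-- `a_i(k) H_m = H_m a_i(k) + 2π kᵐ a_i(k) + 2π (-k)ᵐ b_i^j(k) a_j(-k)`.  Both sides have
continuous matrix elements, so it suffices to compare them after smearing with `f(k)`; there
`a_i(f)` can be moved to the bra and its exchange relation with `a*^j(q)` be inserted in the
integral defining `H_m`. -/
theorem a_hamiltonian (hR : IsExchangeFactor R) (ρ : BoundaryRep R V W) {m : ℕ}
    {T : Module.End ℂ V} (hT : ρ.IsHamiltonian m T) (i : Fin N) (k : ℝ) (ψ : V) :
    ρ.a i k (T ψ) = T (ρ.a i k ψ) + (2 * Real.pi * (k : ℂ) ^ m) • ρ.a i k ψ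
      + (2 * Real.pi * (-k : ℂ) ^ m) • ∑ j, ρ.b i j k (ρ.a j (-k) ψ) := by
  refine ρ.ext_pair fun φ => ?_
  simp only [map_add, map_smul, map_sum, smul_eq_mul]
  have hP := ρ.continuous_density i φ ψ
  obtain ⟨C, hC⟩ := ρ.norm_pow_mul_density_le m i φ ψ
  have ha := ρ.continuous_a i φ ψ
  have hb : Continuous fun k => ∑ j, ρ.pair φ (ρ.b i j k (ρ.a j (-k) ψ)) :=
    continuous_finsetSum _ fun j _ => (ρ.continuous_b_a i j j φ ψ).comp
      (f := fun k : ℝ => (k, -k)) (by fun_prop)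
  have hTc : Continuous fun k => ρ.pair φ (T (ρ.a i k ψ)) := by
    simp only [(hT _ _).2]
    refine continuous_of_dominated (bound := fun q => C * (1 + q ^ 2)⁻¹) (fun k => ?_)
      (fun k => .of_forall fun q => hC q k) (integrable_inv_one_add_sq.const_mul C)
      (.of_forall fun q => ?_)
    · exact (hT _ _).1.aestronglyMeasurable
    · exact continuous_const.mul (hP.comp (f := fun k => (q, k)) (by fun_prop))
  refine congrFun (eq_of_forall_integral_momentumTest_mul_eq
    (F := fun k => ρ.pair φ (ρ.a i k (T ψ)))
    (G := fun k => ρ.pair φ (T (ρ.a i k ψ)) + 2 * Real.pi * (k : ℂ) ^ m * ρ.pair φ (ρ.a i k ψ)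
      + 2 * Real.pi * (-k : ℂ) ^ m * ∑ j, ρ.pair φ (ρ.b i j k (ρ.a j (-k) ψ)))
    (ρ.continuous_a i φ _) (by fun_prop) fun f => ?_) k
  -- Needed to integrate the normal ordered term over `k` last.
  have hfP : Integrable (Function.uncurry fun q k : ℝ => (q : ℂ) ^ m * (f k *
      ∑ j, ρ.pair (ρ.aStarBra j q φ) (ρ.a j q (ρ.a i k ψ)))) (volume.prod volume) := by
    refine Integrable.mono' ((integrable_inv_one_add_sq.const_mul C).mul_prod
      (f.continuous.integrable_of_hasCompactSupport f.hasCompactSupport).norm) ?_ ?_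
    · refine Continuous.aestronglyMeasurable ?_
      exact (by fun_prop : Continuous fun x : ℝ × ℝ => (x.1 : ℂ) ^ m).mul
        ((f.continuous.comp continuous_snd).mul hP)
    · refine .of_forall fun x => ?_
      have := hC x.1 x.2
      simp only [Function.uncurry]
      calc _ = ‖(x.1 : ℂ) ^ m * ∑ j, ρ.pair (ρ.aStarBra j x.1 φ)
            (ρ.a j x.1 (ρ.a i x.2 ψ))‖ * ‖f x.2‖ := by rw [← norm_mul]; congr 1; ring
        _ ≤ _ := by gcongr
  have h1 : ∀ q : ℝ, (q : ℂ) ^ m * ∑ j, ρ.pair (ρ.aStarBra j q (ρ.aSmearedBra i f φ)) (ρ.a j q ψ) =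
      (∫ k, (q : ℂ) ^ m * (f k * ∑ j, ρ.pair (ρ.aStarBra j q φ) (ρ.a j q (ρ.a i k ψ))))
      + f q * (2 * Real.pi * (q : ℂ) ^ m * ρ.pair φ (ρ.a i q ψ))
      + f.reflect q * (2 * Real.pi * (q : ℂ) ^ m *
        ∑ j, ρ.pair φ (ρ.b i j (-q) (ρ.a j q ψ))) := by
    intro q
    simp only [ρ.pair_aStarBra_aSmearedBra hR, Finset.sum_add_distrib, ← ρ.sum_exchangeKernel_a]
    rw [← integral_finsetSum]
    · rw [mul_add, mul_add, ← integral_const_mul]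
      simp only [Finset.mul_sum]
      congr 1
      · congr 1
        rw [Finset.sum_eq_single i (by intro j _ hj; simp [hj.symm]) (by simp), if_pos rfl]
        ring
      · refine Finset.sum_congr rfl fun j _ => ?_
        rw [MomentumTest.reflect_apply]
        ring
    · intro j _
      exact integrable_momentumTest_mul f ((ρ.continuous_exchangeKernel hR i j φ _).comp
        (f := fun k => (k, q)) (by fun_prop))
  have hb' : Continuous fun q => ∑ j, ρ.pair φ (ρ.b i j (-q) (ρ.a j q ψ)) :=
    continuous_finsetSum _ fun j _ => (ρ.continuous_b_a i j j φ ψ).comp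
      (f := fun k : ℝ => (-k, k)) (by fun_prop)
  rw [← ρ.pair_aSmearedBra, (hT _ _).2]
  simp only [h1]
  rw [integral_add, integral_add, integral_integral_swap hfP]
  · simp only [mul_add]
    rw [integral_add, integral_add]
    · congr 1
      · congr 1
        congr 1; ext k
        rw [(hT _ _).2, ← integral_const_mul]
        congr 1; ext q; ring
      · rw [← integral_neg_eq_self]
        simp
    · exact integrable_momentumTest_mul f hTc
    · exact integrable_momentumTest_mul f (by fun_prop)
    · exact (integrable_momentumTest_mul f hTc).add (integrable_momentumTest_mul f (by fun_prop))
    · exact integrable_momentumTest_mul f (by fun_prop)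
  · exact hfP.integral_prod_left
  · exact integrable_momentumTest_mul f (by fun_prop)
  · exact hfP.integral_prod_left.add (integrable_momentumTest_mul f (by fun_prop))
  · exact integrable_momentumTest_mul _ (by fun_prop)

end BoundaryRep

namespace BoundaryRep

variable {N : ℕ} {R : ExchangeFactor N} {V W : Type*}
  [AddCommGroup V] [Module ℂ V] [AddCommGroup W] [Module ℂ W]

/-! ### Commutators of Hamiltonians -/

/-- The matrix element `⟨φ| a*^i(p) a*^j(q) a_j(q) a_i(p) |ψ⟩`, summed over `i` and `j`. -/
def pairDensity (ρ : BoundaryRep R V W) (φ : W) (ψ : V) (p q : ℝ) : ℂ :=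
  ∑ i, ∑ j, ρ.pair (ρ.aStarBra j q (ρ.aStarBra i p φ)) (ρ.a j q (ρ.a i p ψ))

/-- Exchanging the two annihilation operators and the two creation operators produces the same
exchange factor on both sides. -/
theorem pairDensity_comm (ρ : BoundaryRep R V W) (φ : W) (ψ : V) (p q : ℝ) :
    ρ.pairDensity φ ψ p q = ρ.pairDensity φ ψ q p := by
  have h : ∀ i j, ρ.pair (ρ.aStarBra i p (ρ.aStarBra j q φ)) (ρ.a i p (ρ.a j q ψ)) =
      ∑ j₁, ∑ j₂, R q p (j, i) (j₁, j₂) *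
        ρ.pair (ρ.aStarBra i p (ρ.aStarBra j q φ)) (ρ.a j₂ q (ρ.a j₁ p ψ)) := by
    intro i j
    conv_lhs => rw [ρ.a_a_apply i j p q]
    simp only [map_sum, map_smul, smul_eq_mul]
  simp only [pairDensity, h, fun i j ψ => ρ.exchange_aStar_aStar i j p q φ ψ]
  simp only [Finset.sum_sigma']
  exact Finset.sum_bij' (fun x _ => ⟨x.2.2.2, x.2.2.1, x.1, x.2.1⟩)
    (fun x _ => ⟨x.2.2.1, x.2.2.2, x.2.1, x.1⟩)
    (by simp) (by simp) (by simp) (by simp) (by simp)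

theorem integrable_pow_mul_pairDensity (ρ : BoundaryRep R V W) (n m : ℕ) (φ : W) (ψ : V) :
    Integrable (Function.uncurry fun p q : ℝ => (p : ℂ) ^ n * ((q : ℂ) ^ m * ρ.pairDensity φ ψ p q))
      (volume.prod volume) := by
  have h : (Function.uncurry fun p q : ℝ => (p : ℂ) ^ n * ((q : ℂ) ^ m * ρ.pairDensity φ ψ p q)) =
      fun x : ℝ × ℝ => ∑ i, ∑ j, (x.1 : ℂ) ^ n * ((x.2 : ℂ) ^ m *
        ρ.pair (ρ.aStarBra j x.2 (ρ.aStarBra i x.1 φ)) (ρ.a j x.2 (ρ.a i x.1 ψ))) := by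
    ext x
    simp only [Function.uncurry, pairDensity, Finset.mul_sum]
  rw [h]
  refine integrable_finsetSum _ fun i _ => integrable_finsetSum _ fun j _ => ?_
  obtain ⟨hc, hb⟩ := ρ.regular_aStar_aStar_a_a i j j i φ ψ
  obtain ⟨C, hC⟩ := hb (n + 2) (m + 2)
  refine Integrable.mono' ((integrable_inv_one_add_sq.const_mul C).mul_prod
    integrable_inv_one_add_sq) (Continuous.aestronglyMeasurable (by fun_prop))
    (.of_forall fun x => ?_)
  rw [norm_mul, norm_mul, norm_pow, norm_pow, Complex.norm_real, Complex.norm_real,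
    Real.norm_eq_abs, Real.norm_eq_abs, ← sq_abs x.1, ← sq_abs x.2]
  have h1 := hC x.1 x.2
  rw [mul_comm ((1 + |x.1|) ^ (n + 2)), mul_assoc] at h1
  have h2 := norm_pow_mul_le_of_one_add_pow_mul_le (abs_nonneg x.2) (by positivity) h1
  rw [mul_left_comm] at h2
  have h3 : (1 + |x.1|) ^ (n + 2) * (|x.2| ^ m *
      ‖ρ.pair (ρ.aStarBra j x.2 (ρ.aStarBra i x.1 φ)) (ρ.a j x.2 (ρ.a i x.1 ψ))‖) ≤
      C * (1 + |x.2| ^ 2)⁻¹ := h2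
  have h4 := norm_pow_mul_le_of_one_add_pow_mul_le (abs_nonneg x.1) (by positivity) h3
  calc _ ≤ _ := h4
    _ = _ := by ring

theorem integrable_pow_mul_bulkDensity (ρ : BoundaryRep R V W) (n : ℕ) (φ : W) (ψ : V) :
    Integrable fun p : ℝ => (p : ℂ) ^ n * ∑ i, ρ.pair (ρ.aStarBra i p φ) (ρ.a i p ψ) := by
  simp only [Finset.mul_sum]
  refine integrable_finsetSum _ fun i _ => ?_
  obtain ⟨hc, hb⟩ := ρ.regular_aStar_a i i φ ψ
  obtain ⟨C, hC⟩ := hb (n + 2)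
  have hc' : Continuous fun p => ρ.pair (ρ.aStarBra i p φ) (ρ.a i p ψ) :=
    hc.comp (f := fun p : ℝ => (p, p)) (by fun_prop)
  refine Integrable.mono' (integrable_inv_one_add_sq.const_mul C)
    (Continuous.aestronglyMeasurable (by fun_prop)) (.of_forall fun p => ?_)
  rw [norm_mul, norm_pow, Complex.norm_real, Real.norm_eq_abs, ← sq_abs p]
  exact norm_pow_mul_le_of_one_add_pow_mul_le (abs_nonneg p) (norm_nonneg _) (hC p p)

theorem bulkDensity_hamiltonian (hR : IsExchangeFactor R) (ρ : BoundaryRep R V W) {m : ℕ}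
    {T : Module.End ℂ V} (hT : ρ.IsHamiltonian m T) (p : ℝ) (φ : W) (ψ : V) :
    ∑ i, ρ.pair (ρ.aStarBra i p φ) (ρ.a i p (T ψ)) =
      (∫ q : ℝ, (q : ℂ) ^ m * ρ.pairDensity φ ψ p q)
      + 2 * Real.pi * (p : ℂ) ^ m * ∑ i, ρ.pair (ρ.aStarBra i p φ) (ρ.a i p ψ)
      + 2 * Real.pi * (-p : ℂ) ^ m * ρ.reflectedDensity φ ψ (-p) := by
  simp only [ρ.a_hamiltonian hR hT, map_add, map_smul, map_sum, smul_eq_mul,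
    Finset.sum_add_distrib, ← Finset.mul_sum, reflectedDensity, neg_neg, pairDensity, (hT _ _).2]
  rw [← integral_finsetSum _ fun i _ => (hT _ _).1]
  simp only [← Finset.mul_sum]

/-- The product of two Hamiltonians.  Integrability of the reflected density is not a direct
consequence of the regularity of matrix elements, since the growth they allow in the boundary
momenta is not offset by the decay in the bulk momenta; it follows because all other terms are
integrable. -/
theorem hamiltonian_mul_hamiltonian (hR : IsExchangeFactor R) (ρ : BoundaryRep R V W) {n m : ℕ}
    {S T : Module.End ℂ V} (hS : ρ.IsHamiltonian n S) (hT : ρ.IsHamiltonian m T)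
    (φ : W) (ψ : V) :
    Integrable (fun p : ℝ => (p : ℂ) ^ (m + n) * ρ.reflectedDensity φ ψ p) ∧
    ρ.pair φ (S (T ψ)) =
      (∫ p : ℝ, ∫ q : ℝ, (p : ℂ) ^ n * ((q : ℂ) ^ m * ρ.pairDensity φ ψ p q))
      + 2 * Real.pi *
        (∫ p : ℝ, (p : ℂ) ^ (m + n) * ∑ i, ρ.pair (ρ.aStarBra i p φ) (ρ.a i p ψ))
      + 2 * Real.pi * (-1) ^ n * ∫ p : ℝ, (p : ℂ) ^ (m + n) * ρ.reflectedDensity φ ψ p := by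
  obtain ⟨hi, he⟩ := hS φ (T ψ)
  have hA := (ρ.integrable_pow_mul_pairDensity n m φ ψ).integral_prod_left
  simp only [Function.uncurry] at hA
  have hB := (ρ.integrable_pow_mul_bulkDensity (m + n) φ ψ).const_mul (2 * Real.pi : ℂ)
  have hsplit : ∀ p : ℝ, (p : ℂ) ^ n * ∑ i, ρ.pair (ρ.aStarBra i p φ) (ρ.a i p (T ψ)) =
      (∫ q : ℝ, (p : ℂ) ^ n * ((q : ℂ) ^ m * ρ.pairDensity φ ψ p q))
      + 2 * Real.pi * ((p : ℂ) ^ (m + n) * ∑ i, ρ.pair (ρ.aStarBra i p φ) (ρ.a i p ψ))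
      + 2 * Real.pi * (-1) ^ n * (((-p : ℝ) : ℂ) ^ (m + n) * ρ.reflectedDensity φ ψ (-p)) := by
    intro p
    rw [ρ.bulkDensity_hamiltonian hR hT, integral_const_mul]
    have h1 : ((-1 : ℂ) ^ n) * (-1) ^ n = 1 := by rw [← mul_pow]; simp
    have h2 : ((-p : ℝ) : ℂ) ^ (m + n) = (-p : ℂ) ^ m * ((-1) ^ n * (p : ℂ) ^ n) := by
      rw [← mul_pow, neg_one_mul, Complex.ofReal_neg, pow_add]
    rw [h2, pow_add]
    linear_combination (- 2 * Real.pi * (p : ℂ) ^ n * (-p : ℂ) ^ m *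
      ρ.reflectedDensity φ ψ (-p)) * h1
  simp only [hsplit] at hi he
  have hne : (2 * Real.pi * (-1) ^ n : ℂ) ≠ 0 := by
    simp [Real.pi_ne_zero]
  have hC : Integrable fun p : ℝ => 2 * Real.pi * (-1) ^ n *
      (((-p : ℝ) : ℂ) ^ (m + n) * ρ.reflectedDensity φ ψ (-p)) := by
    refine (hi.sub (hA.add hB)).congr (.of_forall fun p => ?_)
    simp only [Pi.sub_apply, Pi.add_apply]
    ring
  have hr : Integrable fun p : ℝ => (p : ℂ) ^ (m + n) * ρ.reflectedDensity φ ψ p := by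
    have h := (hC.const_mul (2 * Real.pi * (-1) ^ n : ℂ)⁻¹).comp_neg
    simpa only [inv_mul_cancel_left₀ hne, neg_neg] using h
  refine ⟨hr, ?_⟩
  have hAB := hA.add hB
  simp only [Pi.add_def] at hAB
  rw [he, integral_add hAB hC, integral_add hA hB, integral_const_mul, integral_const_mul,
    integral_neg_eq_self (fun p : ℝ => (p : ℂ) ^ (m + n) * ρ.reflectedDensity φ ψ p)]

theorem pair_lie_hamiltonian (hR : IsExchangeFactor R) (ρ : BoundaryRep R V W) {n m : ℕ}
    {S T : Module.End ℂ V} (hS : ρ.IsHamiltonian n S) (hT : ρ.IsHamiltonian m T)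
    (φ : W) (ψ : V) :
    ρ.pair φ (⁅S, T⁆ ψ) = 2 * Real.pi * ((-1) ^ n - (-1) ^ m) *
      ∫ p : ℝ, (p : ℂ) ^ (m + n) * ρ.reflectedDensity φ ψ p := by
  rw [Ring.lie_def, LinearMap.sub_apply, map_sub, Module.End.mul_apply, Module.End.mul_apply,
    (ρ.hamiltonian_mul_hamiltonian hR hS hT φ ψ).2, (ρ.hamiltonian_mul_hamiltonian hR hT hS φ ψ).2,
    integral_integral_swap (ρ.integrable_pow_mul_pairDensity n m φ ψ), add_comm n m]
  have h : (∫ q : ℝ, ∫ p : ℝ, (p : ℂ) ^ n * ((q : ℂ) ^ m * ρ.pairDensity φ ψ p q)) =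
      ∫ p : ℝ, ∫ q : ℝ, (p : ℂ) ^ m * ((q : ℂ) ^ n * ρ.pairDensity φ ψ p q) := by
    congr 1; ext q; congr 1; ext p
    rw [ρ.pairDensity_comm φ ψ p q]; ring
  rw [h]
  ring

theorem lie_hamiltonian_eq_zero (hR : IsExchangeFactor R) (ρ : BoundaryRep R V W) {n m : ℕ}
    {S T : Module.End ℂ V} (hS : ρ.IsHamiltonian n S) (hT : ρ.IsHamiltonian m T)
    (hnm : Even n ↔ Even m) : ⁅S, T⁆ = 0 := by
  ext ψ
  refine ρ.ext_pair fun φ => ?_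
  have h : (-1 : ℂ) ^ n = (-1) ^ m := by
    by_cases hn : Even n
    · rw [hn.neg_one_pow, (hnm.mp hn).neg_one_pow]
    · rw [(Nat.not_even_iff_odd.mp hn).neg_one_pow,
        (Nat.not_even_iff_odd.mp (mt hnm.mpr hn)).neg_one_pow]
  rw [ρ.pair_lie_hamiltonian hR hS hT, h]
  simp

/-! ### Odd Hamiltonians vanish in Fock representations -/

section Fock

variable {D : Type*} [NormedAddCommGroup D] [InnerProductSpace ℂ D] {ρ : BoundaryRep R D D} {Ω : D}

/-- The boundary condition `a_i(k) = b_i^j(k) a_j(-k)` is stable under creation: in the commutator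
of `a_i(k) - b_i^j(k) a_j(-k)` with `a*^j(g)` the contact terms cancel by the reflection
constraint, and unitarity of `R` leaves a normal ordered term which contains the same
combination. -/
theorem IsFock.reflect_aStarSmeared (hR : IsExchangeFactor R) (hρ : ρ.IsFock Ω) {ψ : D}
    (hψ : ∀ i k, ρ.a i k ψ = ∑ l, ρ.b i l k (ρ.a l (-k) ψ)) (j : Fin N) (g : MomentumTest)
    (i : Fin N) (k : ℝ) :
    ρ.a i k (ρ.aStarSmeared j g ψ) = ∑ l, ρ.b i l k (ρ.a l (-k) (ρ.aStarSmeared j g ψ)) := by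
  refine ρ.ext_pair fun φ => ?_
  simp only [map_sum, ← ρ.pair_bBra, ρ.pair_a_aStarSmeared hR, Finset.sum_add_distrib, neg_neg]
  have hI : ∀ l, Integrable fun q => g q * ρ.exchangeKernel l j (ρ.bBra i l k φ) ψ (-k) q :=
    fun l => integrable_momentumTest_mul g ((ρ.continuous_exchangeKernel hR l j _ ψ).comp
      (f := fun q => (-k, q)) (by fun_prop))
  have hkernel : ∀ q, ρ.exchangeKernel i j φ ψ k q =
      ∑ l, ρ.exchangeKernel l j (ρ.bBra i l k φ) ψ (-k) q := by
    intro q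
    simp only [exchangeKernel, hψ _ k, ρ.exchange_b_aStar, map_sum, Finset.mul_sum]
    have hunit : ∀ l₂ l₁ j₁, ∑ l, ∑ j₂, R q (-k) (l₂, l₁) (l, j₂) * R (-k) q (l, j₂) (j, j₁) =
        if l₂ = j ∧ l₁ = j₁ then 1 else 0 := by
      intro l₂ l₁ j₁
      have h := congrFun (congrFun (hR.unitarity q (-k)) (l₂, l₁)) (j, j₁)
      rw [Matrix.mul_apply, Fintype.sum_prod_type, Matrix.one_apply] at h
      simpa only [Prod.mk.injEq] using h
    calc _ = ∑ m₁, ∑ m₂, ∑ j₁, ∑ l₂, ∑ l₁, (if l₂ = j ∧ l₁ = j₁ then 1 else 0) *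
          (R k q (i, m₂) (l₂, m₁) *
            ρ.pair (ρ.aStarBra m₂ q φ) (ρ.b m₁ l₁ k (ρ.a j₁ (-k) ψ))) := by
          refine Finset.sum_congr rfl fun m₁ _ => Finset.sum_congr rfl fun m₂ _ =>
            Finset.sum_congr rfl fun j₁ _ => ?_
          rw [Finset.sum_eq_single j (by intro l _ hl; simp [hl]) (by simp),
            Finset.sum_eq_single j₁ (by intro l _ hl; simp [hl]) (by simp)]
          simp
      _ = _ := by
          simp only [← hunit, Finset.sum_mul]
          simp only [Finset.sum_sigma']
          exact Finset.sum_bij'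
            (fun x _ => ⟨x.2.2.2.2.2.1, x.2.2.1, x.2.2.2.2.2.2, x.2.2.2.2.1, x.2.2.2.1, x.1,
              x.2.1⟩)
            (fun y _ => ⟨y.2.2.2.2.2.1, y.2.2.2.2.2.2, y.2.1, y.2.2.2.2.1, y.2.2.2.1, y.1,
              y.2.2.1⟩)
            (by simp) (by simp) (by simp) (by simp) (by intro x _; ring)
  have hcontact : (∑ l, g (-k) * (2 * Real.pi * if l = j then ρ.pair (ρ.bBra i l k φ) ψ else 0)) =
      g (-k) * (2 * Real.pi * ρ.pair φ (ρ.b i j k ψ)) := by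
    rw [Finset.sum_eq_single j (by intro l _ hl; simp [hl]) (by simp), if_pos rfl, ρ.pair_bBra]
  have hreflect : (∑ l, g k * (2 * Real.pi * ρ.pair (ρ.bBra l j (-k) (ρ.bBra i l k φ)) ψ)) =
      g k * (2 * Real.pi * if i = j then ρ.pair φ ψ else 0) := by
    have h := LinearMap.congr_fun (hρ.reflection i j k) ψ
    rw [← Finset.mul_sum, ← Finset.mul_sum]
    simp only [ρ.pair_bBra, ← map_sum]
    rw [LinearMap.sum_apply] at h
    simp only [Module.End.mul_apply] at h
    rw [h]
    split_ifs <;> simp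
  rw [hcontact, hreflect, ρ.pair_bBra, ← integral_finsetSum _ fun l _ => hI l]
  simp only [hkernel, Finset.mul_sum]
  ring

/-- The boundary condition `a_i(k) = b_i^j(k) a_j(-k)` on states created from the vacuum. -/
theorem IsFock.a_eq_b_a (hR : IsExchangeFactor R) (hρ : ρ.IsFock Ω) {ψ : D}
    (hψ : ψ ∈ Submodule.span ℂ {ψ : D | ∃ L : List (Fin N × MomentumTest),
      ψ = (L.map fun x => ρ.aStarSmeared x.1 x.2).prod Ω}) (i : Fin N) (k : ℝ) :
    ρ.a i k ψ = ∑ l, ρ.b i l k (ρ.a l (-k) ψ) := by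
  induction hψ using Submodule.span_induction generalizing i k with
  | mem ψ h =>
    obtain ⟨L, rfl⟩ := h
    induction L generalizing i k with
    | nil => simp [hρ.vacuum]
    | cons x L ih => exact hρ.reflect_aStarSmeared hR ih x.1 x.2 i k
  | zero => simp
  | add x y _ _ hx hy => simp only [map_add, hx i k, hy i k, Finset.sum_add_distrib]
  | smul c x _ hx => simp only [map_smul, hx i k, Finset.smul_sum]

/-- Between states created from the vacuum the bulk density is even in the momentum, because
`b(k)` is unitary. -/
theorem IsFock.bulkDensity_neg (hR : IsExchangeFactor R) (hρ : ρ.IsFock Ω) {φ ψ : D}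
    (hφ : φ ∈ Submodule.span ℂ {ψ : D | ∃ L : List (Fin N × MomentumTest),
      ψ = (L.map fun x => ρ.aStarSmeared x.1 x.2).prod Ω})
    (hψ : ψ ∈ Submodule.span ℂ {ψ : D | ∃ L : List (Fin N × MomentumTest),
      ψ = (L.map fun x => ρ.aStarSmeared x.1 x.2).prod Ω}) (p : ℝ) :
    ∑ i, ρ.pair (ρ.aStarBra i (-p) φ) (ρ.a i (-p) ψ) =
      ∑ i, ρ.pair (ρ.aStarBra i p φ) (ρ.a i p ψ) := by
  have hb : ∀ i l x y, ρ.pair (ρ.b i l p x) y = ρ.pair x (ρ.b l i (-p) y) := by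
    intro i l x y
    rw [← ρ.pair_bBra, hρ.b_adjoint, neg_neg]
  have hr : ∀ l m (x : D), ∑ i, ρ.b l i (-p) (ρ.b i m p x) = if l = m then x else 0 := by
    intro l m x
    have h := LinearMap.congr_fun (hρ.reflection l m (-p)) x
    rw [LinearMap.sum_apply] at h
    simp only [Module.End.mul_apply, neg_neg] at h
    rw [h]
    split_ifs <;> simp
  simp only [hρ.aStar_adjoint]
  symm
  calc ∑ i, ρ.pair (ρ.a i p φ) (ρ.a i p ψ)
      = ∑ i, ∑ l, ∑ m, ρ.pair (ρ.a l (-p) φ) (ρ.b l i (-p) (ρ.b i m p (ρ.a m (-p) ψ))) := by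
        refine Finset.sum_congr rfl fun i _ => ?_
        rw [hρ.a_eq_b_a hR hφ i p, hρ.a_eq_b_a hR hψ i p]
        simp only [map_sum, LinearMap.sum_apply, hb]
        exact Finset.sum_comm
    _ = ∑ l, ∑ m, ρ.pair (ρ.a l (-p) φ) (∑ i, ρ.b l i (-p) (ρ.b i m p (ρ.a m (-p) ψ))) := by
        rw [Finset.sum_comm]
        refine Finset.sum_congr rfl fun l _ => ?_
        rw [Finset.sum_comm]
        simp only [map_sum]
    _ = _ := by
        refine Finset.sum_congr rfl fun l _ => ?_
        simp only [hr]
        rw [Finset.sum_eq_single l (by intro m _ hm; simp [hm.symm]) (by simp), if_pos rfl]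

theorem IsFock.inner_hamiltonian_symm (hρ : ρ.IsFock Ω) {n : ℕ} {T : Module.End ℂ D}
    (hT : ρ.IsHamiltonian n T) (φ ψ : D) : inner ℂ φ (T ψ) = inner ℂ (T φ) ψ := by
  rw [← inner_conj_symm (T φ) ψ, ← hρ.pair_eq_inner, ← hρ.pair_eq_inner, (hT _ _).2, (hT _ _).2,
    ← integral_conj]
  congr 1; ext p
  simp only [map_mul, map_pow, Complex.conj_ofReal, map_sum, hρ.aStar_adjoint, hρ.pair_eq_inner,
    inner_conj_symm]

theorem IsFock.odd_hamiltonian_eq_zero (hR : IsExchangeFactor R) (hρ : ρ.IsFock Ω) {n : ℕ}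
    (hn : Odd n) {T : Module.End ℂ D} (hT : ρ.IsHamiltonian n T) : T = 0 := by
  have h0 : ∀ φ ∈ Submodule.span ℂ {ψ : D | ∃ L : List (Fin N × MomentumTest),
      ψ = (L.map fun x => ρ.aStarSmeared x.1 x.2).prod Ω},
      ∀ ψ ∈ Submodule.span ℂ {ψ : D | ∃ L : List (Fin N × MomentumTest),
      ψ = (L.map fun x => ρ.aStarSmeared x.1 x.2).prod Ω}, inner ℂ φ (T ψ) = 0 := by
    intro φ hφ ψ hψ
    rw [← hρ.pair_eq_inner, (hT _ _).2, ← self_eq_neg, ← integral_neg, ← integral_neg_eq_self]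
    congr 1; ext p
    rw [hρ.bulkDensity_neg hR hφ hψ, Complex.ofReal_neg, hn.neg_pow, neg_mul]
  have h1 : ∀ ψ ∈ Submodule.span ℂ {ψ : D | ∃ L : List (Fin N × MomentumTest),
      ψ = (L.map fun x => ρ.aStarSmeared x.1 x.2).prod Ω}, T ψ = 0 := fun ψ hψ =>
    hρ.cyclic.eq_zero_of_inner_right ℂ fun v hv => h0 v hv ψ hψ
  ext ψ
  exact hρ.cyclic.eq_zero_of_inner_right ℂ fun v hv => by
    rw [hρ.inner_hamiltonian_symm hT, h1 v hv, inner_zero_left]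

end Fock

end BoundaryRep

/-! ### Families of vectors depending on momenta with compact support -/

/-- The families `X → E` of vectors which are finite sums of families `x ↦ F x • v`, where `F` is
continuous with compact support. -/
def compactFamilies (X E : Type*) [TopologicalSpace X] [AddCommGroup E] [Module ℂ E] :
    Submodule ℂ (X → E) :=
  Submodule.span ℂ {Φ | ∃ F : X → ℂ, Continuous F ∧ HasCompactSupport F ∧
    ∃ v : E, Φ = fun x => F x • v}

section Families

variable {X Y E E' : Type*} [TopologicalSpace X] [TopologicalSpace Y]
  [AddCommGroup E] [Module ℂ E] [AddCommGroup E'] [Module ℂ E']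

theorem smul_mem_compactFamilies {F : X → ℂ} (hF : Continuous F) (hF' : HasCompactSupport F)
    (v : E) : (fun x => F x • v) ∈ compactFamilies X E :=
  Submodule.subset_span ⟨F, hF, hF', v, rfl⟩

theorem map_mem_compactFamilies (T : E →ₗ[ℂ] E') {Φ : X → E} (hΦ : Φ ∈ compactFamilies X E) :
    (fun x => T (Φ x)) ∈ compactFamilies X E' := by
  induction hΦ using Submodule.span_induction with
  | mem Φ h =>
    obtain ⟨F, hF, hF', v, rfl⟩ := h
    simpa only [map_smul] using smul_mem_compactFamilies hF hF' (T v)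
  | zero => simpa only [Pi.zero_apply, map_zero] using! zero_mem (compactFamilies X E')
  | add Φ Ψ _ _ h h' => simpa only [Pi.add_apply, map_add] using! add_mem h h'
  | smul c Φ _ h => simpa only [Pi.smul_apply, map_smul] using! Submodule.smul_mem _ c h

theorem HasCompactSupport.mul_prod {F : X → ℂ} {G : Y → ℂ}
    (hF : HasCompactSupport F) (hG : HasCompactSupport G) :
    HasCompactSupport fun x : X × Y => F x.1 * G x.2 := by
  have hK := hF.isCompact.prod hG.isCompact
  refine HasCompactSupport.intro' hK
    ((isClosed_tsupport F).prod (isClosed_tsupport G)) fun x hx => ?_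
  by_contra h
  simp only [mul_eq_zero, not_or] at h
  exact hx ⟨subset_tsupport _ h.1, subset_tsupport _ h.2⟩

theorem pair_compactFamilies (B : E' →ₗ⋆[ℂ] E →ₗ[ℂ] ℂ) {Φ : X → E'} {Ψ : Y → E}
    (hΦ : Φ ∈ compactFamilies X E') (hΨ : Ψ ∈ compactFamilies Y E) :
    Continuous (fun x : X × Y => B (Φ x.1) (Ψ x.2)) ∧
      HasCompactSupport fun x : X × Y => B (Φ x.1) (Ψ x.2) := by
  induction hΦ using Submodule.span_induction with
  | mem Φ h =>
    obtain ⟨F, hF, hF', v, rfl⟩ := h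
    induction hΨ using Submodule.span_induction with
    | mem Ψ h =>
      obtain ⟨G, hG, hG', w, rfl⟩ := h
      simp only [map_smulₛₗ, LinearMap.smul_apply, smul_eq_mul, RingHom.id_apply]
      have hc : HasCompactSupport fun x => (starRingEnd ℂ) (F x) :=
        hF'.comp_left (map_zero (starRingEnd ℂ))
      refine ⟨by fun_prop, ?_⟩
      have h := (hc.mul_prod hG').mul_right (f' := fun _ => B v w)
      refine h.mono fun x hx => ?_
      simp only [Function.mem_support, Pi.mul_apply] at hx ⊢
      contrapose! hx
      rw [← hx]
      ring
    | zero => simpa using ⟨continuous_zero, HasCompactSupport.zero⟩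
    | add Ψ Ψ' _ _ h h' =>
      simp only [Pi.add_apply, map_add]
      exact ⟨h.1.add h'.1, h.2.add h'.2⟩
    | smul c Ψ _ h =>
      simp only [Pi.smul_apply, map_smul, smul_eq_mul]
      exact ⟨h.1.const_mul c, h.2.mul_left (f := fun _ => c)⟩
  | zero => simpa using ⟨continuous_zero, HasCompactSupport.zero⟩
  | add Ψ Ψ' _ _ h h' =>
    simp only [Pi.add_apply, map_add, LinearMap.add_apply]
    exact ⟨h.1.add h'.1, h.2.add h'.2⟩
  | smul c Ψ _ h =>
    simp only [Pi.smul_apply, map_smulₛₗ, LinearMap.smul_apply, smul_eq_mul]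
    exact ⟨h.1.const_mul _, h.2.mul_left (f := fun _ => (starRingEnd ℂ) c)⟩

/-- Products of operators which depend on momenta through compact families do so, too. -/
theorem ofFn_prod_mem_compactFamilies {J : Type*} {A : J → ℝ → Module.End ℂ E}
    (hA : ∀ j v, (fun k => A j k v) ∈ compactFamilies ℝ E) {s : ℕ} (J' : Fin s → J) (v : E) :
    (fun p : Fin s → ℝ => (List.ofFn fun x => A (J' x) (p x)).prod v) ∈
      compactFamilies (Fin s → ℝ) E := by
  induction s with
  | zero =>
    simp only [List.ofFn_zero, List.prod_nil, Module.End.one_apply]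
    simpa only [one_smul] using smul_mem_compactFamilies (X := Fin 0 → ℝ) (F := fun _ => 1)
      continuous_const (HasCompactSupport.of_compactSpace _) v
  | succ s ih =>
    simp only [List.ofFn_succ, List.prod_cons, Module.End.mul_apply]
    have h : ∀ Φ ∈ compactFamilies (Fin s → ℝ) E,
        (fun p : Fin (s + 1) → ℝ => A (J' 0) (p 0) (Φ fun x => p x.succ)) ∈
          compactFamilies (Fin (s + 1) → ℝ) E := by
      intro Φ hΦ
      induction hΦ using Submodule.span_induction with
      | mem Φ h =>
        obtain ⟨F, hF, hF', w, rfl⟩ := h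
        simp only [map_smul]
        have h : ∀ Ψ ∈ compactFamilies ℝ E,
            (fun p : Fin (s + 1) → ℝ => F (fun x => p x.succ) • Ψ (p 0)) ∈
              compactFamilies (Fin (s + 1) → ℝ) E := by
          intro Ψ hΨ
          induction hΨ using Submodule.span_induction with
          | mem Ψ h =>
            obtain ⟨G, hG, hG', u, rfl⟩ := h
            simp only [smul_smul]
            refine smul_mem_compactFamilies (by fun_prop) ?_ u
            have := (hF'.mul_prod hG').comp_homeomorph
              ((Fin.consEquivL ℝ (fun _ : Fin (s + 1) => ℝ)).symm.toHomeomorph.trans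
                (Homeomorph.prodComm _ _))
            exact this
          | zero =>
            simpa only [Pi.zero_apply, smul_zero] using! zero_mem (compactFamilies (Fin (s + 1) → ℝ) E)
          | add Φ Ψ _ _ h h' => simpa only [Pi.add_apply, smul_add] using! add_mem h h'
          | smul c Φ _ h =>
            simpa only [Pi.smul_apply, smul_comm _ c] using! Submodule.smul_mem _ c h
        exact h _ (hA (J' 0) w)
      | zero =>
        simpa only [Pi.zero_apply, map_zero] using! zero_mem (compactFamilies (Fin (s + 1) → ℝ) E)
      | add Φ Ψ _ _ h h' => simpa only [Pi.add_apply, map_add] using! add_mem h h'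
      | smul c Φ _ h => simpa only [Pi.smul_apply, map_smul] using! Submodule.smul_mem _ c h
    exact h _ (ih fun x => J' x.succ)

end Families

/-! ### Gaussian pairings on polynomial algebras -/

namespace BosonFock

open MvPolynomial

variable {ι : Type*}

/-- The derivation of the polynomial algebra with `∂ X_x = u x`, an annihilation operator. -/
def lower (u : ι → ℂ) : Derivation ℂ (MvPolynomial ι ℂ) (MvPolynomial ι ℂ) :=
  mkDerivation ℂ fun x => C (u x)

@[simp]
theorem lower_X (u : ι → ℂ) (x : ι) : lower u (X x) = C (u x) := mkDerivation_X _ _ _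

theorem lower_X_mul (u : ι → ℂ) (x : ι) (φ : MvPolynomial ι ℂ) :
    lower u (X x * φ) = u x • φ + X x * lower u φ := by
  rw [Derivation.leibniz, lower_X, smul_eq_mul, smul_eq_mul, smul_eq_C_mul]
  ring

theorem lower_comm (u v : ι → ℂ) (φ : MvPolynomial ι ℂ) :
    lower u (lower v φ) = lower v (lower u φ) := by
  have h : ⁅lower u, lower v⁆ = 0 := derivation_ext fun x => by simp [Derivation.commutator_apply]
  rw [← sub_eq_zero, ← Derivation.commutator_apply, h, Derivation.zero_apply]

theorem lower_eq_sum (u : ι → ℂ) (φ : MvPolynomial ι ℂ) :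
    lower u φ = ∑ x ∈ φ.vars, u x • pderiv x φ := by
  classical
  have h : lower u φ = (∑ x ∈ φ.vars, u x • pderiv (R := ℂ) x :
      Derivation ℂ (MvPolynomial ι ℂ) (MvPolynomial ι ℂ)) φ := by
    refine derivation_eq_of_forall_mem_vars fun y hy => ?_
    rw [← Derivation.coeFnAddMonoidHom_apply (∑ x ∈ φ.vars, _), map_sum, Finset.sum_apply,
      Finset.sum_eq_single y]
    · simp [smul_eq_C_mul]
    · intro x _ hxy
      simp [pderiv_X_of_ne hxy.symm]
    · exact fun h => absurd hy h
  rw [h, ← Derivation.coeFnAddMonoidHom_apply, map_sum, Finset.sum_apply]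
  rfl

/-- The algebra homomorphism `X_x ↦ ∂_{u x}` from polynomials to differential operators. -/
theorem exists_lowerHom (u : ι → ι → ℂ) :
    ∃ Θ : MvPolynomial ι ℂ →ₐ[ℂ] Module.End ℂ (MvPolynomial ι ℂ),
      ∀ x, Θ (X x) = (lower (u x) : MvPolynomial ι ℂ →ₗ[ℂ] MvPolynomial ι ℂ) := by
  let s : Set (Module.End ℂ (MvPolynomial ι ℂ)) := {T | ∃ v : ι → ℂ, T = (lower v : _ →ₗ[ℂ] _)}
  have hs : ∀ a ∈ s, ∀ b ∈ s, a * b = b * a := by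
    rintro _ ⟨v, rfl⟩ _ ⟨w, rfl⟩
    exact LinearMap.ext fun φ => lower_comm v w φ
  have := Algebra.isMulCommutative_adjoin ℂ hs
  open scoped IsMulCommutative in
  exact ⟨(Algebra.adjoin ℂ s).val.comp (aeval fun x =>
    (⟨(lower (u x) : _ →ₗ[ℂ] _), Algebra.subset_adjoin ⟨u x, rfl⟩⟩ : Algebra.adjoin ℂ s)),
    fun x => by simp⟩

variable (B : ι → ι → ℂ)

/-- `Θ (X_x) = ∂_x`, where `∂_x X_y = B x y`. -/
def lowerHom : MvPolynomial ι ℂ →ₐ[ℂ] Module.End ℂ (MvPolynomial ι ℂ) :=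
  (exists_lowerHom B).choose

theorem lowerHom_X (x : ι) :
    lowerHom B (X x) = (lower (B x) : MvPolynomial ι ℂ →ₗ[ℂ] MvPolynomial ι ℂ) :=
  (exists_lowerHom B).choose_spec x

/-- The sesquilinear pairing of bosonic Fock space, in which `X_x` is adjoint to the derivation
`∂_x` with `∂_x X_y = B x y`. -/
def fockPair : MvPolynomial ι ℂ →ₗ⋆[ℂ] MvPolynomial ι ℂ →ₗ[ℂ] ℂ :=
  LinearMap.mk₂'ₛₗ (starRingEnd ℂ) (RingHom.id ℂ)
    (fun φ ψ => constantCoeff (lowerHom B (map (starRingEnd ℂ) φ) ψ))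
    (fun φ φ' ψ => by simp only [map_add, LinearMap.add_apply])
    (fun c φ ψ => by
      rw [smul_eq_C_mul, map_mul, MvPolynomial.map_C, map_mul, Module.End.mul_apply,
        ← algebraMap_eq, AlgHom.commutes, Module.algebraMap_end_apply, constantCoeff_smul])
    (fun φ ψ ψ' => by simp only [map_add])
    (fun c φ ψ => by
      rw [map_smul, constantCoeff_smul, RingHom.id_apply])

theorem fockPair_C (a : ℂ) (ψ : MvPolynomial ι ℂ) :
    fockPair B (C a) ψ = (starRingEnd ℂ) a * constantCoeff ψ := by
  rw [fockPair, LinearMap.mk₂'ₛₗ_apply, MvPolynomial.map_C, ← algebraMap_eq, AlgHom.commutes,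
    Module.algebraMap_end_apply, constantCoeff_smul, smul_eq_mul]

theorem fockPair_X_mul (x : ι) (φ ψ : MvPolynomial ι ℂ) :
    fockPair B (X x * φ) ψ = fockPair B φ (lower (B x) ψ) := by
  rw [fockPair, LinearMap.mk₂'ₛₗ_apply, mul_comm, map_mul, MvPolynomial.map_X, map_mul, lowerHom_X,
    Module.End.mul_apply]
  rfl

/-- If `B` is Hermitian, creation and annihilation operators are adjoint to each other. -/
theorem fockPair_mul_X (hB : ∀ x y, (starRingEnd ℂ) (B x y) = B y x) (x : ι)
    (φ ψ : MvPolynomial ι ℂ) :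
    fockPair B φ (X x * ψ) = fockPair B (lower (B x) φ) ψ := by
  induction φ using MvPolynomial.induction_on generalizing ψ with
  | C a => simp [fockPair_C]
  | add φ φ' h h' => simp only [map_add, LinearMap.add_apply, h, h']
  | mul_X φ y h =>
    rw [mul_comm φ, fockPair_X_mul, lower_X_mul, lower_X_mul, map_add, h, map_add,
      LinearMap.add_apply, fockPair_X_mul, map_smul, map_smulₛₗ, LinearMap.smul_apply, hB]

end BosonFock

/-! ### A boson field with a partially reflecting boundary -/

/-- The exchange factor of bosons without internal scattering: the flip
`e_{i₁} ⊗ e_{i₂} ↦ e_{i₂} ⊗ e_{i₁}`. -/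
def flipFactor (N : ℕ) : ExchangeFactor N :=
  fun _ _ => Matrix.of fun i j => if j = i.swap then 1 else 0

theorem flipFactor_apply {N : ℕ} (k₁ k₂ : ℝ) (i₁ i₂ j₁ j₂ : Fin N) :
    flipFactor N k₁ k₂ (i₁, i₂) (j₁, j₂) = if j₁ = i₂ then (if j₂ = i₁ then 1 else 0) else 0 := by
  simp [flipFactor, ite_and]

theorem isExchangeFactor_flipFactor (N : ℕ) : IsExchangeFactor (flipFactor N) where
  continuous := continuous_const
  unitarity k₁ k₂ := by
    ext ⟨i₁, i₂⟩ ⟨j₁, j₂⟩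
    simp only [Matrix.mul_apply, Fintype.sum_prod_type, flipFactor_apply, Matrix.one_apply,
      Prod.mk.injEq]
    simp
    grind
  yangBaxter k₁ k₂ k₃ := by
    ext ⟨i₁, i₂, i₃⟩ ⟨j₁, j₂, j₃⟩
    simp only [Matrix.mul_apply, Fintype.sum_prod_type, onFirstTwo, onLastTwo, Matrix.of_apply,
      flipFactor_apply]
    simp
    grind

namespace BosonFock

open MvPolynomial CompactlySupported ComplexConjugate

/-- One-particle states with a colour index. -/
abbrev OneParticle (N : ℕ) : Type := Fin N × C_c(ℝ, ℂ)

/-- A momentum test function as a one-particle wave function. -/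
def ofTest (f : MomentumTest) : C_c(ℝ, ℂ) := ⟨⟨f, f.continuous⟩, f.hasCompactSupport⟩

@[simp] theorem ofTest_apply (f : MomentumTest) (k : ℝ) : ofTest f k = f k := rfl

/-- The complex conjugate of a momentum test function. -/
def conjTest (f : MomentumTest) : C_c(ℝ, ℂ) :=
  ⟨⟨fun k => conj (f k), by fun_prop⟩, f.hasCompactSupport.comp_left (map_zero conj)⟩

@[simp] theorem conjTest_apply (f : MomentumTest) (k : ℝ) : conjTest f k = conj (f k) := rfl

/-- The reflected function `k ↦ f (-k)`. -/
def reflect (f : C_c(ℝ, ℂ)) : C_c(ℝ, ℂ) :=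
  ⟨⟨fun k => f (-k), by fun_prop⟩, f.hasCompactSupport.comp_homeomorph (Homeomorph.neg ℝ)⟩

@[simp] theorem reflect_apply (f : C_c(ℝ, ℂ)) (k : ℝ) : reflect f k = f (-k) := rfl

/-- The contact term `2π (f(k) + c f(-k))` of `a(k)` with `a*(f)`. -/
def contact (c : ℝ) (f : C_c(ℝ, ℂ)) : C_c(ℝ, ℂ) := (2 * Real.pi : ℂ) • (f + (c : ℂ) • reflect f)

theorem contact_apply (c : ℝ) (f : C_c(ℝ, ℂ)) (k : ℝ) :
    contact c f k = 2 * Real.pi * (f k + c * f (-k)) := by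
  simp [contact]

/-- `f ↦ pⁿ f`. -/
def powMul (n : ℕ) (f : C_c(ℝ, ℂ)) : C_c(ℝ, ℂ) :=
  ⟨⟨fun p => (p : ℂ) ^ n * f p, by fun_prop⟩, f.hasCompactSupport.mul_left⟩

@[simp] theorem powMul_apply (n : ℕ) (f : C_c(ℝ, ℂ)) (p : ℝ) : powMul n f p = (p : ℂ) ^ n * f p :=
  rfl

variable {N : ℕ}

/-- The values of `a_i(k)` on one-particle states. -/
def mode (c : ℝ) (i : Fin N) (k : ℝ) (x : OneParticle N) : ℂ :=
  if x.1 = i then contact c x.2 k else 0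

/-- The one-particle scalar product `2π ∫ conj f(k) (g(k) + c g(-k)) dk`. It is positive for
`|c| < 1`. -/
def form (c : ℝ) (x y : OneParticle N) : ℂ := ∫ k, conj (x.2 k) * mode c x.1 k y

theorem continuous_mode (c : ℝ) (i : Fin N) (x : OneParticle N) :
    Continuous fun k => mode c i k x := by
  unfold mode
  split_ifs
  · exact map_continuous _
  · exact continuous_const

theorem hasCompactSupport_mode (c : ℝ) (i : Fin N) (x : OneParticle N) :
    HasCompactSupport fun k => mode c i k x := by
  unfold mode
  split_ifs
  · exact (contact c x.2).hasCompactSupport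
  · exact HasCompactSupport.zero

theorem integrable_mul (f g : C_c(ℝ, ℂ)) : Integrable fun k => conj (f k) * g k :=
  Continuous.integrable_of_hasCompactSupport (by fun_prop) g.hasCompactSupport.mul_left

theorem conj_form (c : ℝ) (x y : OneParticle N) : conj (form c x y) = form c y x := by
  unfold form mode
  rw [← integral_conj]
  by_cases h : x.1 = y.1
  · simp only [h, if_true, contact_apply]
    have h1 := integrable_mul y.2 x.2
    have h2 := integrable_mul (reflect y.2) x.2
    have h3 := integrable_mul y.2 (reflect x.2)
    have e : ∫ k, conj (reflect y.2 k) * x.2 k = ∫ k, conj (y.2 k) * reflect x.2 k := by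
      rw [← integral_neg_eq_self]
      simp
    calc _ = ∫ k, (2 * Real.pi : ℂ) * (conj (y.2 k) * x.2 k + c * (conj (reflect y.2 k) * x.2 k)) := by
          congr 1; ext k
          simp only [map_mul, map_add, Complex.conj_conj, Complex.conj_ofReal, map_ofNat, reflect_apply]
          ring
      _ = ∫ k, (2 * Real.pi : ℂ) * (conj (y.2 k) * x.2 k + c * (conj (y.2 k) * reflect x.2 k)) := by
          rw [integral_const_mul, integral_const_mul, integral_add h1 (h2.const_mul _),
            integral_add h1 (h3.const_mul _), integral_const_mul, integral_const_mul, e]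
      _ = _ := by congr 1; ext k; simp; ring
  · simp [h, Ne.symm h]

/-- The annihilation operator `a_i(k)` on polynomials, before null vectors are divided out. -/
abbrev annih (c : ℝ) (i : Fin N) (k : ℝ) :
    Derivation ℂ (MvPolynomial (OneParticle N) ℂ) (MvPolynomial (OneParticle N) ℂ) :=
  lower (mode c i k)

theorem annih_mem_compactFamilies (c : ℝ) (i : Fin N) (φ : MvPolynomial (OneParticle N) ℂ) :
    (fun k => annih c i k φ) ∈ compactFamilies ℝ (MvPolynomial (OneParticle N) ℂ) := by
  simp only [annih, lower_eq_sum]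
  have h := Submodule.sum_mem (compactFamilies ℝ (MvPolynomial (OneParticle N) ℂ)) (t := φ.vars)
    (f := fun x k => mode c i k x • pderiv x φ)
    fun x _ => smul_mem_compactFamilies (continuous_mode c i x) (hasCompactSupport_mode c i x) _
  convert h using 1
  ext1 k
  rw [Finset.sum_apply]

/-- The sesquilinear pairing of the boson field. -/
abbrev bosonPair (c : ℝ) :
    MvPolynomial (OneParticle N) ℂ →ₗ⋆[ℂ] MvPolynomial (OneParticle N) ℂ →ₗ[ℂ] ℂ :=
  fockPair (form c)

theorem bosonPair_mul_X (c : ℝ) (x : OneParticle N) (φ ψ : MvPolynomial (OneParticle N) ℂ) :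
    bosonPair c φ (X x * ψ) = bosonPair c (lower (form c x) φ) ψ :=
  fockPair_mul_X _ (conj_form c) x φ ψ

theorem bosonPair_lower_right (c : ℝ) (x : OneParticle N) (φ ψ : MvPolynomial (OneParticle N) ℂ) :
    bosonPair c φ (lower (form c x) ψ) =
      ∫ k, conj (x.2 k) * bosonPair c φ (annih c x.1 k ψ) := by
  have hI : ∀ y, Integrable fun k => conj (x.2 k) * mode c x.1 k y := fun y =>
    Continuous.integrable_of_hasCompactSupport
      (by have := continuous_mode c x.1 y; fun_prop) (hasCompactSupport_mode c x.1 y).mul_left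
  simp only [annih, lower_eq_sum, map_sum, map_smul, smul_eq_mul, Finset.mul_sum]
  rw [integral_finsetSum]
  · refine Finset.sum_congr rfl fun y _ => ?_
    simp only [← mul_assoc]
    rw [integral_mul_const, form]
  · intro y _
    simp only [← mul_assoc]
    exact (hI y).mul_const _

theorem bosonPair_lower_left (c : ℝ) (x : OneParticle N) (φ ψ : MvPolynomial (OneParticle N) ℂ) :
    bosonPair c (lower (form c x) φ) ψ =
      ∫ k, x.2 k * bosonPair c (annih c x.1 k φ) ψ := by
  have hI : ∀ y, Integrable fun k => x.2 k * conj (mode c x.1 k y) := fun y =>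
    Continuous.integrable_of_hasCompactSupport
      (by have := continuous_mode c x.1 y; fun_prop) x.2.hasCompactSupport.mul_right
  simp only [annih, lower_eq_sum, map_sum, map_smulₛₗ, LinearMap.sum_apply, LinearMap.smul_apply,
    smul_eq_mul, Finset.mul_sum]
  rw [integral_finsetSum]
  · refine Finset.sum_congr rfl fun y _ => ?_
    simp only [← mul_assoc]
    rw [integral_mul_const, form, ← integral_conj]
    simp
  · intro y _
    simp only [← mul_assoc]
    exact (hI y).mul_const _

theorem continuous_bosonPair_annih_annih (c : ℝ) (i j : Fin N)
    (φ ψ : MvPolynomial (OneParticle N) ℂ) :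
    Continuous (fun k : ℝ × ℝ => bosonPair c (annih c i k.1 φ) (annih c j k.2 ψ)) ∧
    HasCompactSupport (fun k : ℝ × ℝ => bosonPair c (annih c i k.1 φ) (annih c j k.2 ψ)) :=
  pair_compactFamilies _ (annih_mem_compactFamilies c i φ) (annih_mem_compactFamilies c j ψ)

theorem continuous_bosonPair_annih (c : ℝ) (i : Fin N) (φ ψ : MvPolynomial (OneParticle N) ℂ) :
    Continuous fun k => bosonPair c φ (annih c i k ψ) := by
  have h := continuous_mode (N := N) c i
  simp only [annih, lower_eq_sum, map_sum, map_smul, smul_eq_mul]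
  fun_prop

/-- The Hamiltonian `∫ pⁿ a*^i(p) a_i(p) dp`, the second quantization of `f ↦ pⁿ contact f`. -/
def hamiltonian (c : ℝ) (n : ℕ) :
    Derivation ℂ (MvPolynomial (OneParticle N) ℂ) (MvPolynomial (OneParticle N) ℂ) :=
  mkDerivation ℂ fun x => X (x.1, powMul n (contact c x.2))

theorem integrable_hamiltonian (c : ℝ) (n : ℕ) (φ ψ : MvPolynomial (OneParticle N) ℂ) :
    Integrable fun p : ℝ => (p : ℂ) ^ n * ∑ i, bosonPair c (annih c i p φ) (annih c i p ψ) := by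
  simp only [Finset.mul_sum]
  refine integrable_finsetSum _ fun i _ => ?_
  obtain ⟨h1, h2⟩ := continuous_bosonPair_annih_annih c i i φ ψ
  have h1' := h1.comp (f := fun p : ℝ => (p, p)) (by fun_prop)
  have h2' : HasCompactSupport fun p : ℝ => bosonPair c (annih c i p φ) (annih c i p ψ) := by
    refine HasCompactSupport.of_support_subset_isCompact
      (h2.isCompact.image continuous_fst) fun p hp => ⟨(p, p), subset_tsupport _ hp, rfl⟩
  exact Continuous.integrable_of_hasCompactSupport
    (by exact (by fun_prop : Continuous fun p : ℝ => (p : ℂ) ^ n).mul h1') h2'.mul_left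

theorem bosonPair_hamiltonian (c : ℝ) (n : ℕ) (φ ψ : MvPolynomial (OneParticle N) ℂ) :
    bosonPair c φ (hamiltonian c n ψ) =
      ∫ p : ℝ, (p : ℂ) ^ n * ∑ i, bosonPair c (annih c i p φ) (annih c i p ψ) := by
  induction ψ using MvPolynomial.induction_on generalizing φ with
  | C a => simp [derivation_C]
  | add ψ ψ' h h' =>
    simp only [map_add, h, h', Finset.sum_add_distrib, mul_add]
    rw [integral_add (integrable_hamiltonian c n φ ψ) (integrable_hamiltonian c n φ ψ')]
  | mul_X ψ x h =>
    have e : hamiltonian c n (X x * ψ) =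
        X (x.1, powMul n (contact c x.2)) * ψ + X x * hamiltonian c n ψ := by
      rw [Derivation.leibniz, hamiltonian, mkDerivation_X, smul_eq_mul, smul_eq_mul]
      ring
    have hI : Integrable fun p : ℝ => (p : ℂ) ^ n * contact c x.2 p *
        bosonPair c (annih c x.1 p φ) ψ := by
      have h1 := (pair_compactFamilies (Y := ℝ) (bosonPair c) (annih_mem_compactFamilies c x.1 φ)
        (smul_mem_compactFamilies (map_continuous (contact c x.2))
          (contact c x.2).hasCompactSupport ψ))
      have h2 := h1.1.comp (f := fun p : ℝ => (p, p)) (by fun_prop)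
      have h3 : HasCompactSupport fun p : ℝ => (p : ℂ) ^ n * contact c x.2 p *
          bosonPair c (annih c x.1 p φ) ψ :=
        (contact c x.2).hasCompactSupport.mul_left.mul_right
      refine Continuous.integrable_of_hasCompactSupport ?_ h3
      refine ((by fun_prop : Continuous fun p : ℝ => (p : ℂ) ^ n).mul h2).congr fun p => ?_
      simp [mul_assoc]
    rw [mul_comm ψ, e, map_add, bosonPair_mul_X, bosonPair_mul_X, h, bosonPair_lower_left]
    simp only [powMul_apply]
    rw [← integral_add hI (integrable_hamiltonian c n _ ψ)]
    congr 1; ext p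
    simp only [annih, lower_X_mul, map_add, map_smul, smul_eq_mul, Finset.sum_add_distrib,
      bosonPair_mul_X, lower_comm (form c x), mode, ite_mul, zero_mul, Finset.sum_ite_eq,
      Finset.mem_univ, if_true]
    ring

/-! ### Passage to the quotient by the null vectors -/

/-- The null vectors of the pairing. -/
def nullSpace (N : ℕ) (c : ℝ) : Submodule ℂ (MvPolynomial (OneParticle N) ℂ) :=
  LinearMap.ker (bosonPair (N := N) c).flip

theorem mem_nullSpace {c : ℝ} {ψ : MvPolynomial (OneParticle N) ℂ} :
    ψ ∈ nullSpace N c ↔ ∀ φ, bosonPair c φ ψ = 0 := by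
  rw [nullSpace, LinearMap.mem_ker, LinearMap.ext_iff]
  rfl

theorem nullSpace_le_comap_annih (c : ℝ) (i : Fin N) (k : ℝ) :
    nullSpace N c ≤ (nullSpace N c).comap (annih c i k).toLinearMap := by
  intro ψ hψ
  rw [Submodule.mem_comap, mem_nullSpace]
  intro φ
  refine congrFun (eq_of_forall_integral_momentumTest_mul_eq
    (continuous_bosonPair_annih c i φ ψ) continuous_zero fun f => ?_) k
  have h := bosonPair_lower_right c (i, conjTest f) φ ψ
  rw [← fockPair_X_mul, mem_nullSpace.mp hψ] at h
  simpa using h.symm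

theorem nullSpace_le_comap_X_mul (c : ℝ) (x : OneParticle N) :
    nullSpace N c ≤ (nullSpace N c).comap (LinearMap.mulLeft ℂ (X x)) := by
  intro ψ hψ
  rw [Submodule.mem_comap, mem_nullSpace]
  intro φ
  rw [LinearMap.mulLeft_apply, bosonPair_mul_X, mem_nullSpace.mp hψ]

theorem nullSpace_le_comap_hamiltonian (c : ℝ) (n : ℕ) :
    nullSpace N c ≤ (nullSpace N c).comap (hamiltonian c n).toLinearMap := by
  intro ψ hψ
  rw [Submodule.mem_comap, mem_nullSpace]
  intro φ
  have h : ∀ i p φ, bosonPair c φ (annih c i p ψ) = 0 := fun i p φ =>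
    mem_nullSpace.mp (nullSpace_le_comap_annih c i p hψ) φ
  rw [Derivation.coeFn_coe, bosonPair_hamiltonian]
  simp [h]

end BosonFock

namespace BosonFock

open MvPolynomial CompactlySupported ComplexConjugate

variable {N : ℕ}

/-- The domain of the boson field: polynomials in the creation operators modulo null vectors. -/
abbrev Domain (N : ℕ) (c : ℝ) : Type := MvPolynomial (OneParticle N) ℂ ⧸ nullSpace N c

/-- The pairing of `Domain` with polynomials. -/
def quotPair (N : ℕ) (c : ℝ) : MvPolynomial (OneParticle N) ℂ →ₗ⋆[ℂ] Domain N c →ₗ[ℂ] ℂ where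
  toFun φ := (nullSpace N c).liftQ (bosonPair c φ) fun ψ hψ => mem_nullSpace.mp hψ φ
  map_add' φ φ' := LinearMap.ext fun ψ => by
    obtain ⟨ψ, rfl⟩ := Submodule.Quotient.mk_surjective _ ψ
    exact LinearMap.congr_fun (map_add (bosonPair c) φ φ') ψ
  map_smul' a φ := LinearMap.ext fun ψ => by
    obtain ⟨ψ, rfl⟩ := Submodule.Quotient.mk_surjective _ ψ
    exact LinearMap.congr_fun (map_smulₛₗ (bosonPair c) a φ) ψ

@[simp]
theorem quotPair_mk (c : ℝ) (φ ψ : MvPolynomial (OneParticle N) ℂ) :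
    quotPair N c φ (Submodule.Quotient.mk ψ) = bosonPair c φ ψ := rfl

/-- `a_i(k)` on `Domain`. -/
def quotAnnih (N : ℕ) (c : ℝ) (i : Fin N) (k : ℝ) : Module.End ℂ (Domain N c) :=
  (nullSpace N c).mapQ (nullSpace N c) (annih c i k).toLinearMap (nullSpace_le_comap_annih c i k)

@[simp]
theorem quotAnnih_mk (c : ℝ) (i : Fin N) (k : ℝ) (ψ : MvPolynomial (OneParticle N) ℂ) :
    quotAnnih N c i k (Submodule.Quotient.mk ψ) = Submodule.Quotient.mk (annih c i k ψ) := rfl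

/-- Creation operators on `Domain`. -/
def quotCreate (N : ℕ) (c : ℝ) (x : OneParticle N) : Module.End ℂ (Domain N c) :=
  (nullSpace N c).mapQ (nullSpace N c) (LinearMap.mulLeft ℂ (X x)) (nullSpace_le_comap_X_mul c x)

@[simp]
theorem quotCreate_mk (c : ℝ) (x : OneParticle N) (ψ : MvPolynomial (OneParticle N) ℂ) :
    quotCreate N c x (Submodule.Quotient.mk ψ) = Submodule.Quotient.mk (X x * ψ) := rfl

/-- The Hamiltonians on `Domain`. -/
def quotHamiltonian (N : ℕ) (c : ℝ) (n : ℕ) : Module.End ℂ (Domain N c) :=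
  (nullSpace N c).mapQ (nullSpace N c) (hamiltonian c n).toLinearMap (nullSpace_le_comap_hamiltonian c n)

theorem quotAnnih_mem_compactFamilies (c : ℝ) (i : Fin N) (ψ : Domain N c) :
    (fun k => quotAnnih N c i k ψ) ∈ compactFamilies ℝ (Domain N c) := by
  obtain ⟨ψ, rfl⟩ := Submodule.Quotient.mk_surjective _ ψ
  exact map_mem_compactFamilies (nullSpace N c).mkQ (annih_mem_compactFamilies c i ψ)

/-- The scalar `c δ_i^j`, by which the boundary generator `b_i^j(k)` acts. -/
def reflection (c : ℝ) (i j : Fin N) : ℂ := if i = j then (c : ℂ) else 0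

theorem ofFn_smul_one_prod {E : Type*} [AddCommGroup E] [Module ℂ E] {t : ℕ} (d : Fin t → ℂ) :
    (List.ofFn fun x => d x • (1 : Module.End ℂ E)).prod = (∏ x, d x) • 1 := by
  induction t with
  | zero => simp
  | succ t ih => rw [List.ofFn_succ, List.prod_cons, ih, Fin.prod_univ_succ, smul_mul_smul_comm,
      one_mul]

theorem pow_mul_norm_le_of_hasCompactSupport {r s : ℕ} {F : (Fin r → ℝ) × (Fin s → ℝ) → ℂ}
    (hF : Continuous F) (hF' : HasCompactSupport F) (m : ℕ) :
    ∃ C : ℝ, ∀ k p, (1 + ‖k‖ + ‖p‖) ^ m * ‖F (k, p)‖ ≤ C := by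
  have hc : Continuous fun x => (((1 + ‖x.1‖ + ‖x.2‖) ^ m : ℝ) : ℂ) * F x := by fun_prop
  obtain ⟨C, hC⟩ := hc.bounded_above_of_compact_support hF'.mul_left
  refine ⟨C, fun k p => ?_⟩
  have h := hC (k, p)
  rwa [norm_mul, Complex.norm_real, Real.norm_of_nonneg (by positivity)] at h

theorem bosonField_regular (c : ℝ) (r t s : ℕ) (I : Fin r → Fin N) (B : Fin t → Fin N × Fin N)
    (J : Fin s → Fin N) (φ : MvPolynomial (OneParticle N) ℂ) (ψ : Domain N c) :
    let M : (Fin r → ℝ) → (Fin t → ℝ) → (Fin s → ℝ) → ℂ := fun k _ p =>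
      quotPair N c ((List.ofFn fun x => ((annih c (I x) (k x)).toLinearMap :
          Module.End ℂ (MvPolynomial (OneParticle N) ℂ))).reverse.prod φ)
        ((List.ofFn fun x => reflection c (B x).1 (B x).2 • (1 : Module.End ℂ (Domain N c))).prod
          ((List.ofFn fun x => quotAnnih N c (J x) (p x)).prod ψ))
    (Continuous fun x : (Fin r → ℝ) × (Fin t → ℝ) × (Fin s → ℝ) => M x.1 x.2.1 x.2.2) ∧
      ∀ m : ℕ, ∃ (C : ℝ) (d : ℕ), ∀ k l p,
        (1 + ‖k‖ + ‖p‖) ^ m * ‖M k l p‖ ≤ C * (1 + ‖l‖) ^ d := by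
  intro M
  have hrev : ∀ k : Fin r → ℝ, (List.ofFn fun x => ((annih c (I x) (k x)).toLinearMap :
      Module.End ℂ (MvPolynomial (OneParticle N) ℂ))).reverse.prod =
      (List.ofFn fun x => ((annih c (I x) (k x)).toLinearMap :
      Module.End ℂ (MvPolynomial (OneParticle N) ℂ))).prod := fun k =>
    (List.reverse_perm _).prod_eq' <| List.pairwise_reverse.mpr <| List.pairwise_ofFn.mpr
      fun x y _ => LinearMap.ext fun φ => lower_comm _ _ φ
  obtain ⟨h1, h2⟩ := pair_compactFamilies (quotPair N c)
    (ofFn_prod_mem_compactFamilies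
      (A := fun i k => ((annih c i k).toLinearMap :
        Module.End ℂ (MvPolynomial (OneParticle N) ℂ)))
      (annih_mem_compactFamilies c) I φ)
    (ofFn_prod_mem_compactFamilies (quotAnnih_mem_compactFamilies c) J ψ)
  have hM : M = fun k _ p => (∏ x, reflection c (B x).1 (B x).2) *
      quotPair N c ((List.ofFn fun x => ((annih c (I x) (k x)).toLinearMap :
          Module.End ℂ (MvPolynomial (OneParticle N) ℂ))).prod φ)
        ((List.ofFn fun x => quotAnnih N c (J x) (p x)).prod ψ) := by
    ext k l p
    simp only [M, hrev, ofFn_smul_one_prod, LinearMap.smul_apply, Module.End.one_apply, map_smul,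
      smul_eq_mul]
  rw [hM]
  refine ⟨(h1.comp (f := fun x : (Fin r → ℝ) × (Fin t → ℝ) × (Fin s → ℝ) => (x.1, x.2.2))
    (by fun_prop)).const_mul _, fun m => ?_⟩
  obtain ⟨C, hC⟩ := pow_mul_norm_le_of_hasCompactSupport (h1.const_mul
    (∏ x, reflection c (B x).1 (B x).2)) h2.mul_left m
  exact ⟨C, 0, fun k l p => by simpa using hC k p⟩

theorem bosonField_exchange_a_aStar (c : ℝ) (i j : Fin N) (f g : MomentumTest)
    (φ ψ : MvPolynomial (OneParticle N) ℂ) :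
    bosonPair c (X (i, conjTest f) * φ) (X (j, ofTest g) * ψ) =
      (∫ k : ℝ × ℝ, f k.1 * g k.2 * bosonPair c (annih c j k.2 φ) (annih c i k.1 ψ))
      + 2 * Real.pi * (∫ k : ℝ, f k * g k) * (if i = j then bosonPair c φ ψ else 0)
      + 2 * Real.pi * ∫ k : ℝ, f k * g (-k) * (reflection c i j * bosonPair c φ ψ) := by
  have h1 := fockPair_X_mul (form c) (i, conjTest f) φ (X (j, ofTest g) * ψ)
  have h2 := bosonPair_mul_X c (j, ofTest g) φ (lower (form c (i, conjTest f)) ψ)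
  rw [bosonPair_lower_right] at h2
  rw [h1, lower_X_mul, map_add, map_smul, h2]
  simp only [bosonPair_lower_left, conjTest_apply, Complex.conj_conj, ofTest_apply]
  have hK : Continuous fun x : ℝ × ℝ => bosonPair c (annih c j x.2 φ) (annih c i x.1 ψ) :=
    (continuous_bosonPair_annih_annih c j i φ ψ).1.comp
      (f := fun x : ℝ × ℝ => (x.2, x.1)) (by fun_prop)
  have e := integral_momentumTest_prod_fst f g
    (K := fun k q => bosonPair c (annih c j q φ) (annih c i k ψ)) hK
  rw [e, smul_eq_mul, form, integral_mul_const]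
  simp only [mode, reflection, conjTest_apply, Complex.conj_conj]
  by_cases h : i = j
  · subst h
    have h1 := integrable_momentumTest_mul f g.continuous
    have h2 := integrable_momentumTest_mul f g.reflect.continuous
    simp only [MomentumTest.reflect_apply] at h2
    have e : (∫ k, f k * contact c (ofTest g) k) =
        2 * Real.pi * ((∫ k, f k * g k) + c * ∫ k, f k * g (-k)) := by
      rw [← integral_const_mul, ← integral_add h1 (h2.const_mul _), ← integral_const_mul]
      congr 1; ext k
      rw [contact_apply, ofTest_apply, ofTest_apply]
      ring
    simp only [if_true, e]
    ring
  · simp [h, Ne.symm h]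

theorem conj_reflection (c : ℝ) (i j : Fin N) : conj (reflection c i j) = reflection c i j := by
  unfold reflection
  split_ifs <;> simp

/-- The boson field with boundary generators `b_i^j(k) = c δ_i^j`, as a representation of the
boundary algebra.  For `0 < |c| < 1` the boundary is partially reflecting: the pairing is positive, but
the reflection constraint `b(k) b(-k) = 1` of Fock representations fails. -/
def bosonField (N : ℕ) (c : ℝ) :
    BoundaryRep (flipFactor N) (Domain N c) (MvPolynomial (OneParticle N) ℂ) where
  pair := quotPair N c
  pair_separates ψ h := by
    obtain ⟨ψ, rfl⟩ := Submodule.Quotient.mk_surjective _ ψ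
    exact (Submodule.Quotient.mk_eq_zero _).mpr (mem_nullSpace.mpr h)
  a := quotAnnih N c
  aStarBra i k := (annih c i k).toLinearMap
  b i j _ := reflection c i j • 1
  bBra i j _ := reflection c i j • 1
  pair_bBra i j k φ ψ := by
    simp [conj_reflection]
  aStarSmeared i f := quotCreate N c (i, ofTest f)
  pair_aStarSmeared i f φ ψ := by
    obtain ⟨ψ, rfl⟩ := Submodule.Quotient.mk_surjective _ ψ
    rw [quotCreate_mk, quotPair_mk, bosonPair_mul_X, bosonPair_lower_left]
    rfl
  aSmearedBra i f := LinearMap.mulLeft ℂ (X (i, conjTest f))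
  pair_aSmearedBra i f φ ψ := by
    obtain ⟨ψ, rfl⟩ := Submodule.Quotient.mk_surjective _ ψ
    rw [quotPair_mk, LinearMap.mulLeft_apply, fockPair_X_mul, bosonPair_lower_right]
    simp
  regular r t s I B J φ ψ := bosonField_regular c r t s I B J φ ψ
  exchange_aa i₁ i₂ k₁ k₂ := by
    refine LinearMap.ext fun ψ => ?_
    obtain ⟨ψ, rfl⟩ := Submodule.Quotient.mk_surjective _ ψ
    simp [flipFactor_apply, lower_comm (mode c i₁ k₁)]
  exchange_aStar_aStar i₁ i₂ k₁ k₂ φ ψ := by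
    simp [flipFactor_apply, lower_comm (mode c i₂ k₂)]
  exchange_a_aStar i₁ i₂ f g φ ψ := by
    obtain ⟨ψ, rfl⟩ := Submodule.Quotient.mk_surjective _ ψ
    have h := bosonField_exchange_a_aStar c i₁ i₂ f g φ ψ
    simpa [flipFactor_apply] using h
  exchange_bb i₁ i₂ j₁ j₂ k₁ k₂ := by
    simp [flipFactor_apply, smul_smul, mul_comm]
  exchange_ab i₁ i₂ j₂ k₁ k₂ := by
    simp [flipFactor_apply]
  exchange_b_aStar i₁ j₁ i₂ k₁ k₂ φ ψ := by
    simp [flipFactor_apply, conj_reflection]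

theorem isHamiltonian_quotHamiltonian (c : ℝ) (n : ℕ) :
    (bosonField N c).IsHamiltonian n (quotHamiltonian N c n) := by
  intro φ ψ
  obtain ⟨ψ, rfl⟩ := Submodule.Quotient.mk_surjective _ ψ
  exact ⟨integrable_hamiltonian c n φ ψ, bosonPair_hamiltonian c n φ ψ⟩

/-- A continuous function supported in the positive half-line. -/
def tent : C_c(ℝ, ℂ) :=
  ⟨⟨fun p => ((max 0 (1 - |p - 2|) : ℝ) : ℂ), by fun_prop⟩, by
    refine HasCompactSupport.intro (isCompact_Icc (a := (1 : ℝ)) (b := 3)) fun p hp => ?_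
    rw [Complex.ofReal_eq_zero, max_eq_left]
    by_contra! h
    have := abs_lt.mp (by linarith : |p - 2| < 1)
    exact hp ⟨by linarith, by linarith⟩⟩

theorem tent_apply (p : ℝ) : tent p = ((max 0 (1 - |p - 2|) : ℝ) : ℂ) := rfl

/-- If the boundary is neither transparent nor totally reflecting, Hamiltonians of opposite parity
do not commute: between suitable one-particle states the reflected density is a multiple of
`tent²`, which lives on positive momenta only, so that its odd moments do not vanish. -/
theorem lie_quotHamiltonian_ne_zero {c : ℝ} (hc : c ≠ 0) (hc' : c ^ 2 ≠ 1) (hN : 1 ≤ N) {n m : ℕ}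
    (hnm : ¬(Even n ↔ Even m)) : ⁅quotHamiltonian N c n, quotHamiltonian N c m⁆ ≠ 0 := by
  intro h0
  let i : Fin N := ⟨0, hN⟩
  -- The bra is chosen so that the reflection of its contact term is a multiple of `tent`.
  let g : C_c(ℝ, ℂ) := reflect tent - (c : ℂ) • tent
  have h := (bosonField N c).pair_lie_hamiltonian (isExchangeFactor_flipFactor N)
    (isHamiltonian_quotHamiltonian c n) (isHamiltonian_quotHamiltonian c m)
    (X (i, g)) (Submodule.Quotient.mk (X (i, tent)))
  rw [h0, LinearMap.zero_apply, map_zero, eq_comm, mul_eq_zero] at h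
  have hodd : Odd (m + n) := by
    rw [Nat.odd_add]
    grind
  have hpar : ((-1 : ℂ) ^ n - (-1) ^ m) ≠ 0 := by
    rcases Nat.even_or_odd n with hn | hn
    · have hm : Odd m := by grind
      rw [hn.neg_one_pow, hm.neg_one_pow]; norm_num
    · have hm : Even m := by grind
      rw [hn.neg_one_pow, hm.neg_one_pow]; norm_num
  have h := h.resolve_left (by simp [Real.pi_ne_zero, hpar])
  let w : ℝ → ℝ := fun p => p ^ (m + n) * (max 0 (1 - |p - 2|)) ^ 2
  have hw : ∀ p : ℝ, (p : ℂ) ^ (m + n) *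
      (bosonField N c).reflectedDensity (X (i, g)) (Submodule.Quotient.mk (X (i, tent))) p =
      ((2 * Real.pi) ^ 2 * c * (1 - c ^ 2) : ℝ) * (w p : ℂ) := by
    intro p
    -- `tent` and its reflection have disjoint supports.
    have hzero : tent p * tent (-p) = 0 := by
      rw [tent_apply, tent_apply, ← Complex.ofReal_mul, Complex.ofReal_eq_zero, mul_eq_zero]
      rcases le_total p 0 with hp | hp
      · left
        rw [max_eq_left]
        rw [abs_of_nonpos (by linarith)]; linarith
      · right
        rw [max_eq_left]
        rw [abs_of_nonpos (by linarith)]; linarith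
    have hd : (bosonField N c).reflectedDensity (X (i, g)) (Submodule.Quotient.mk (X (i, tent))) p =
        c * (conj (contact c g (-p)) * contact c tent p) := by
      have ha : ∀ j, (bosonField N c).a j p (Submodule.Quotient.mk (X (i, tent))) =
          Submodule.Quotient.mk (C (mode c j p (i, tent))) := fun j =>
        congrArg Submodule.Quotient.mk (lower_X _ _)
      have has : ∀ j, (bosonField N c).aStarBra j (-p) (X (i, g)) = C (mode c j (-p) (i, g)) :=
        fun j => lower_X _ _
      have hb : ∀ j l v, (bosonField N c).b j l (-p) v = reflection c j l • v := fun _ _ _ => rfl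
      have hp : ∀ a b : ℂ, (bosonField N c).pair (C a) (Submodule.Quotient.mk (C b)) =
          conj a * b := fun a b => by
        refine (fockPair_C (form c) a (C b)).trans ?_
        rw [constantCoeff_C]
      simp only [BoundaryRep.reflectedDensity, ha, has, hb, map_smul, hp, mode, reflection,
        smul_eq_mul]
      rw [Finset.sum_eq_single i (by intro j _ hj; simp [hj.symm]) (by simp),
        Finset.sum_eq_single i (by intro j _ hj; simp [hj.symm]) (by simp)]
      simp only [if_true]
    have hg : contact c g (-p) = 2 * Real.pi * (1 - c ^ 2) * tent p := by
      simp only [contact_apply, g, CompactlySupportedContinuousMap.coe_sub,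
        CompactlySupportedContinuousMap.coe_smul, Pi.sub_apply, Pi.smul_apply, reflect_apply,
        smul_eq_mul, neg_neg]
      ring
    have hconj : conj (tent p) = tent p := Complex.conj_ofReal _
    have hsq : (w p : ℂ) = (p : ℂ) ^ (m + n) * tent p ^ 2 := by
      rw [tent_apply]
      push_cast [w]
      rfl
    rw [hd, hg, hsq, contact_apply]
    simp only [map_mul, map_sub, map_one, map_pow, Complex.conj_ofReal, map_ofNat, hconj]
    push_cast
    linear_combination ((p : ℂ) ^ (m + n) * c * ((2 * Real.pi) ^ 2 * (1 - c ^ 2)) * c) * hzero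
  simp only [hw] at h
  rw [integral_const_mul, mul_eq_zero, integral_complex_ofReal] at h
  have hw0 : 0 < ∫ p, w p := by
    refine Continuous.integral_pos_of_hasCompactSupport_nonneg_nonzero (x := 2)
      (by fun_prop) ?_ (fun p => ?_) ?_
    · refine HasCompactSupport.mono tent.hasCompactSupport fun p hp => ?_
      rw [Function.mem_support] at hp ⊢
      contrapose! hp
      rw [tent_apply, Complex.ofReal_eq_zero] at hp
      simp [w, hp]
    · rcases le_total p 0 with hp | hp
      · have : max 0 (1 - |p - 2|) = 0 := by
          rw [max_eq_left]
          rw [abs_of_nonpos (by linarith)]; linarith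
        simp [w, this]
      · simp only [w]
        positivity
    · simp [w]
  rcases h with h | h
  · have h1 : (1 - c ^ 2) ≠ 0 := sub_ne_zero.mpr (Ne.symm hc')
    rw [Complex.ofReal_eq_zero] at h
    exact mul_ne_zero (mul_ne_zero (by positivity) hc) h1 h
  · exact hw0.ne' (Complex.ofReal_eq_zero.mp h)

end BosonFock

end

theorem mainTheorem7 :
    -- in every representation of the boundary algebra
    (∀ (N : ℕ) (R : ExchangeFactor N), IsExchangeFactor R →
      ∀ (V W : Type*) [AddCommGroup V] [Module ℂ V] [AddCommGroup W] [Module ℂ W]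
        (ρ : BoundaryRep R V W),
        (∀ (n : ℕ) (Hn : Module.End ℂ V), ρ.IsHamiltonian n Hn →
          (∀ i j k, ⁅Hn, ρ.b i j k⁆ = 0) ∧ (∀ X ∈ ρ.boundarySubalgebra, ⁅Hn, X⁆ = 0)) ∧
        (∀ (n m : ℕ) (Hn Hm : Module.End ℂ V), ρ.IsHamiltonian n Hn → ρ.IsHamiltonian m Hm →
          (∀ φ ψ,
            Integrable (fun p : ℝ => (p : ℂ) ^ (m + n) * ρ.reflectedDensity φ ψ p) ∧
            ρ.pair φ (⁅Hn, Hm⁆ ψ) =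
              2 * Real.pi * ((-1) ^ n - (-1) ^ m) *
                ∫ p : ℝ, (p : ℂ) ^ (m + n) * ρ.reflectedDensity φ ψ p) ∧
          ((Even n ↔ Even m) → ⁅Hn, Hm⁆ = 0))) ∧
    -- Hamiltonians of opposite parity do not commute in general
    (∀ N : ℕ, 1 ≤ N → ∃ (R : ExchangeFactor N) (_ : IsExchangeFactor R)
      (V W : Type) (_ : AddCommGroup V) (_ : Module ℂ V) (_ : AddCommGroup W) (_ : Module ℂ W)
      (ρ : BoundaryRep R V W) (H : ℕ → Module.End ℂ V),
      (∀ n, ρ.IsHamiltonian n (H n)) ∧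
      ∀ n m, ¬ (Even n ↔ Even m) → ⁅H n, H m⁆ ≠ 0) ∧
    -- the odd Hamiltonians vanish in every Fock representation
    (∀ (N : ℕ) (R : ExchangeFactor N), IsExchangeFactor R →
      ∀ (D : Type*) [NormedAddCommGroup D] [InnerProductSpace ℂ D]
        (ρ : BoundaryRep R D D) (Ω : D), ρ.IsFock Ω →
        ∀ (n : ℕ) (T : Module.End ℂ D), ρ.IsHamiltonian (2 * n + 1) T → T = 0) := by
  refine ⟨fun N R hR V W _ _ _ _ ρ => ⟨fun n Hn hn => ⟨ρ.lie_hamiltonian_b hn,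
      fun X hX => ρ.lie_hamiltonian_of_mem_boundarySubalgebra hn hX⟩,
      fun n m Hn Hm hn hm => ⟨fun φ ψ => ⟨(ρ.hamiltonian_mul_hamiltonian hR hn hm φ ψ).1,
        ρ.pair_lie_hamiltonian hR hn hm φ ψ⟩, ρ.lie_hamiltonian_eq_zero hR hn hm⟩⟩,
    fun N hN => ⟨flipFactor N, isExchangeFactor_flipFactor N, _, _, _, _, _, _,
      BosonFock.bosonField N (1 / 2), BosonFock.quotHamiltonian N (1 / 2),
      BosonFock.isHamiltonian_quotHamiltonian _, fun n m hnm =>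
        BosonFock.lie_quotHamiltonian_ne_zero (by norm_num) (by norm_num) hN hnm⟩,
    fun N R hR D _ _ ρ Ω hΩ n T hT => hΩ.odd_hamiltonian_eq_zero hR ⟨n, rfl⟩ hT⟩
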